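/- Let $A$ be a unital $C^*$-algebra and let $\alpha\colon\mathbb{T}\to\mathrm{Aut}(A)$ be a continuous action of the circle with the Rokhlin property: for every $\varepsilon>0$ and every finite set $F\subseteq A$ there is a unitary $u\in A$ with $\|\alpha_\zeta(u)-\zeta u\|<\varepsilon$ for all $\zeta\in\mathbb{T}$ and $\|ua-au\|<\varepsilon$ for all $a\in F$. Write $A^\alpha$ for the fixed point algebra, $A\rtimes_\alpha\mathbb{T}$ for the crossed product, and $\mathcal{K}(L^2(\mathbb{T}))$ for the compact operators on $L^2(\mathbb{T})$. Then there exists a unitary $u\in A$ with $\alpha_\zeta(u)=\zeta u$ for all $\zeta\in\mathbb{T}$ (equivalently, a presentation of $\alpha$ as the dual action on the crossed product of $A^\alpha$ by the automorphism $\mathrm{Ad}(u)|_{A^\alpha}$), and there are $*$-isomorphisms $$\Psi_{A,\alpha,u}\colon A\rtimes_\alpha\mathbb{T}\;\longrightarrow\; A^\alpha\otimes\mathcal{K}(L^2(\mathbb{T})),$$ one for each such triple $(A,\alpha,u)$ ($\alpha$ with the Rokhlin property, $u\in A$ a unitary with $\alpha_\zeta(u)=\zeta u$ for all $\zeta$),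 which are natural in the following sense: if $(A,\alpha,u)$ and $(B,\beta,v)$ are two such triples and $\varphi\colon A\to B$ is a unital $*$-homomorphism with $\varphi\circ\alpha_\zeta=\beta_\zeta\circ\varphi$ for all $\zeta\in\mathbb{T}$ and $\varphi(u)=v$, then $$\Psi_{B,\beta,v}\circ(\varphi\rtimes\mathbb{T})=\bigl(\varphi|_{A^\alpha}\otimes\mathrm{id}_{\mathcal{K}(L^2(\mathbb{T}))}\bigr)\circ\Psi_{A,\alpha,u}.$$ -/

import Mathlib

open MeasureTheory UniformSpace TensorProduct

noncomputable section

namespace CircleRokhlin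

/-! ### Enveloping C*-algebras of *-algebras -/

section Envelope

variable {X Y Z : Type*}
  [NonUnitalRing X] [StarRing X] [Module ℂ X] [IsScalarTower ℂ X X] [SMulCommClass ℂ X X]
  [StarModule ℂ X]
  [NonUnitalRing Y] [StarRing Y] [Module ℂ Y] [IsScalarTower ℂ Y Y] [SMulCommClass ℂ Y Y]
  [StarModule ℂ Y]

/-- A C*-seminorm on a complex *-algebra. -/
structure IsCStarSeminorm (p : Seminorm ℂ X) : Prop where
  map_mul_le : ∀ x y, p (x * y) ≤ p x * p y
  map_star_mul_self : ∀ x, p (star x * x) = p x ^ 2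

theorem IsCStarSeminorm.map_star {p : Seminorm ℂ X} (hp : IsCStarSeminorm p) (x : X) :
    p (star x) = p x := by
  have key : ∀ y, p y ≤ p (star y) := by
    intro y
    have h1 := hp.map_star_mul_self y
    have h2 := hp.map_mul_le (star y) y
    by_contra hlt
    have h3 : 0 ≤ p (star y) := apply_nonneg p _
    have h4 : p (star y) < p y := not_le.mp hlt
    nlinarith
  refine le_antisymm ?_ (key x)
  simpa using key (star x)

/-- The greatest C*-seminorm which is dominated by the function `b`. -/
def maxCStarSeminorm (b : X → ℝ) : Seminorm ℂ X :=
  sSup {p | IsCStarSeminorm p ∧ ∀ x, p x ≤ b x}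

theorem maxCStarSeminorm_apply (b : X → ℝ) (x : X) :
    maxCStarSeminorm b x =
      ⨆ p : {p : Seminorm ℂ X | IsCStarSeminorm p ∧ ∀ x, p x ≤ b x}, (p : Seminorm ℂ X) x := by
  refine Seminorm.sSup_apply (Seminorm.bddAbove_iff.mpr ⟨b, ?_⟩)
  rintro _ ⟨p, hp, rfl⟩ x
  exact hp.2 x

theorem bddAbove_range_cstarSeminorm (b : X → ℝ) (x : X) :
    BddAbove (Set.range fun p : {p : Seminorm ℂ X | IsCStarSeminorm p ∧ ∀ x, p x ≤ b x} =>
      (p : Seminorm ℂ X) x) := by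
  refine ⟨b x, ?_⟩
  rintro _ ⟨p, rfl⟩
  exact p.2.2 x

theorem le_maxCStarSeminorm {b : X → ℝ} {p : Seminorm ℂ X} (hp : IsCStarSeminorm p)
    (hb : ∀ x, p x ≤ b x) (x : X) : p x ≤ maxCStarSeminorm b x := by
  rw [maxCStarSeminorm_apply]
  exact le_ciSup (bddAbove_range_cstarSeminorm b x) ⟨p, hp, hb⟩

theorem maxCStarSeminorm_le {b : X → ℝ} {x : X} {r : ℝ} (hr : 0 ≤ r)
    (h : ∀ p : Seminorm ℂ X, IsCStarSeminorm p → (∀ y, p y ≤ b y) → p x ≤ r) :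
    maxCStarSeminorm b x ≤ r := by
  rw [maxCStarSeminorm_apply]
  exact Real.iSup_le (fun p => h p.1 p.2.1 p.2.2) hr

theorem isCStarSeminorm_max (b : X → ℝ) : IsCStarSeminorm (maxCStarSeminorm b) where
  map_mul_le x y := by
    have h1 : 0 ≤ maxCStarSeminorm b x := apply_nonneg _ _
    have h2 : 0 ≤ maxCStarSeminorm b y := apply_nonneg _ _
    refine maxCStarSeminorm_le (mul_nonneg h1 h2) fun p hp hb => ?_
    exact (hp.map_mul_le x y).trans (mul_le_mul (le_maxCStarSeminorm hp hb x)
      (le_maxCStarSeminorm hp hb y) (apply_nonneg _ _) h1)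
  map_star_mul_self x := by
    refine le_antisymm ?_ ?_
    · refine maxCStarSeminorm_le (sq_nonneg _) fun p hp hb => ?_
      rw [hp.map_star_mul_self]
      exact pow_le_pow_left₀ (apply_nonneg _ _) (le_maxCStarSeminorm hp hb x) 2
    · have h0 : 0 ≤ maxCStarSeminorm b (star x * x) := apply_nonneg _ _
      have : maxCStarSeminorm b x ≤ Real.sqrt (maxCStarSeminorm b (star x * x)) := by
        refine maxCStarSeminorm_le (Real.sqrt_nonneg _) fun p hp hb => ?_
        refine Real.le_sqrt_of_sq_le ?_
        rw [← hp.map_star_mul_self]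
        exact le_maxCStarSeminorm hp hb _
      calc maxCStarSeminorm b x ^ 2
          ≤ Real.sqrt (maxCStarSeminorm b (star x * x)) ^ 2 :=
            pow_le_pow_left₀ (apply_nonneg _ _) this 2
        _ = _ := Real.sq_sqrt h0

/-- A *-algebra as a seminormed ring, with the greatest C*-seminorm dominated by `b`. -/
abbrev envelopeRing (b : X → ℝ) : NonUnitalSeminormedRing X :=
  { (inferInstance : NonUnitalRing X) with
    norm := maxCStarSeminorm b
    dist := fun x y => maxCStarSeminorm b (-x + y)
    dist_self := fun x => by rw [neg_add_cancel, map_zero]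
    dist_comm := fun x y => by rw [← map_neg_eq_map, neg_add, neg_neg, add_comm]
    dist_triangle := fun x y z => by
      refine le_trans (le_of_eq ?_) (map_add_le_add (maxCStarSeminorm b) _ _)
      congr 1
      abel
    dist_eq := fun _ _ => rfl
    norm_mul_le := (isCStarSeminorm_max b).map_mul_le }

/-- The scalar multiplication is compatible with the greatest C*-seminorm. -/
abbrev envelopeSpace (b : X → ℝ) :
    @NormedSpace ℂ X _ (envelopeRing b).toSeminormedAddCommGroup :=
  letI := envelopeRing b
  { (inferInstance : Module ℂ X) with
    norm_smul_le := fun a x => (map_smul_eq_mul (maxCStarSeminorm b) a x).le }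

/-- The *-algebra `X`, seminormed by the greatest C*-seminorm dominated by `b`. -/
def PreEnvelope (_b : X → ℝ) : Type _ := X

variable (b : X → ℝ) (c : Y → ℝ)

instance : NonUnitalSeminormedRing (PreEnvelope b) := envelopeRing (X := X) b
instance : NormedSpace ℂ (PreEnvelope b) := envelopeSpace (X := X) b
instance : StarRing (PreEnvelope b) := ‹StarRing X›
instance : IsScalarTower ℂ (PreEnvelope b) (PreEnvelope b) := ‹IsScalarTower ℂ X X›
instance : SMulCommClass ℂ (PreEnvelope b) (PreEnvelope b) := ‹SMulCommClass ℂ X X›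
instance : StarModule ℂ (PreEnvelope b) := ‹StarModule ℂ X›
instance : NormedStarGroup (PreEnvelope b) where
  norm_star_le x := ((isCStarSeminorm_max b).map_star x).le

/-- The enveloping C*-algebra: the Hausdorff completion of the *-algebra `X` with respect to the
greatest C*-seminorm dominated by `b`. -/
def CStarEnvelope (b : X → ℝ) : Type _ := Completion (PreEnvelope b)

namespace CStarEnvelope

/-! The multiplication and the involution extend to the completion by continuity. -/

variable {b}

abbrev Cpl (b : X → ℝ) : Type _ := Completion (PreEnvelope b)

/-- Multiplication on the completion. -/
def cmul (z w : Cpl b) : Cpl b :=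
  (Completion.isDenseInducing_coe.prodMap
      (Completion.isDenseInducing_coe (α := PreEnvelope b))).extend
      ((fun x : PreEnvelope b => (x : Cpl b)) ∘
        Function.uncurry (· * · : PreEnvelope b → PreEnvelope b → PreEnvelope b)) (z, w)

/-- The involution on the completion. -/
def cstar (z : Cpl b) : Cpl b := Completion.map (star : PreEnvelope b → PreEnvelope b) z

theorem cmul_coe (x y : PreEnvelope b) : cmul (x : Cpl b) y = ((x * y : PreEnvelope b) : Cpl b) :=
  ((Completion.isDenseInducing_coe.prodMap
    (Completion.isDenseInducing_coe (α := PreEnvelope b))).extend_eq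
      ((Completion.continuous_coe (PreEnvelope b)).comp
        (continuous_mul (M := PreEnvelope b))) (x, y))

theorem continuous_cmul' : Continuous fun z : Cpl b × Cpl b => cmul z.1 z.2 := by
  let m := (AddMonoidHom.mul : PreEnvelope b →+ PreEnvelope b →+ PreEnvelope b).compr₂
    Completion.toCompl
  have h : Continuous fun p : PreEnvelope b × PreEnvelope b => m p.1 p.2 :=
    (Completion.continuous_coe _).comp continuous_mul
  have di : IsDenseInducing
      (Completion.toCompl : PreEnvelope b → Completion (PreEnvelope b)) :=
    Completion.isDenseInducing_coe
  exact (di.extend_Z_bilin di h :)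

@[fun_prop]
theorem continuous_cmul {T : Type*} [TopologicalSpace T] {f g : T → Cpl b} (hf : Continuous f)
    (hg : Continuous g) : Continuous fun t => cmul (f t) (g t) :=
  continuous_cmul'.comp (hf.prodMk hg)

theorem cstar_coe (x : PreEnvelope b) : cstar (x : Cpl b) = ((star x : PreEnvelope b) : Cpl b) :=
  Completion.map_coe
    (starₗᵢ ℂ : PreEnvelope b ≃ₗᵢ⋆[ℂ] PreEnvelope b).isometry.uniformContinuous x

@[fun_prop]
theorem continuous_cstar {T : Type*} [TopologicalSpace T] {f : T → Cpl b} (hf : Continuous f) :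
    Continuous fun t => cstar (f t) :=
  Completion.continuous_map.comp hf

theorem cmul_zero (z : Cpl b) : cmul z 0 = 0 := by
  refine Completion.induction_on z (isClosed_eq (by fun_prop) continuous_const) fun x => ?_
  rw [← Completion.coe_zero, cmul_coe, mul_zero]

theorem zero_cmul (z : Cpl b) : cmul 0 z = 0 := by
  refine Completion.induction_on z (isClosed_eq (by fun_prop) continuous_const) fun x => ?_
  rw [← Completion.coe_zero, cmul_coe, zero_mul]

theorem cmul_assoc (x y z : Cpl b) : cmul (cmul x y) z = cmul x (cmul y z) := by
  refine Completion.induction_on₃ x y z (isClosed_eq (by fun_prop) (by fun_prop)) fun x y z => ?_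
  simp only [cmul_coe, mul_assoc]

theorem cmul_add (x y z : Cpl b) : cmul x (y + z) = cmul x y + cmul x z := by
  refine Completion.induction_on₃ x y z (isClosed_eq (by fun_prop) (by fun_prop)) fun x y z => ?_
  simp only [cmul_coe, mul_add, ← Completion.coe_add]

theorem add_cmul (x y z : Cpl b) : cmul (x + y) z = cmul x z + cmul y z := by
  refine Completion.induction_on₃ x y z (isClosed_eq (by fun_prop) (by fun_prop)) fun x y z => ?_
  simp only [cmul_coe, add_mul, ← Completion.coe_add]

theorem smul_cmul (a : ℂ) (x y : Cpl b) : cmul (a • x) y = a • cmul x y := by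
  refine Completion.induction_on₂ x y (isClosed_eq
    (continuous_cmul ((continuous_fst).const_smul a) continuous_snd)
    ((continuous_cmul continuous_fst continuous_snd).const_smul a)) fun x y => ?_
  simp only [cmul_coe, ← Completion.coe_smul, smul_mul_assoc]

theorem cmul_smul (a : ℂ) (x y : Cpl b) : cmul x (a • y) = a • cmul x y := by
  refine Completion.induction_on₂ x y (isClosed_eq
    (continuous_cmul continuous_fst ((continuous_snd).const_smul a))
    ((continuous_cmul continuous_fst continuous_snd).const_smul a)) fun x y => ?_
  simp only [cmul_coe, ← Completion.coe_smul, mul_smul_comm]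

theorem cstar_cstar (x : Cpl b) : cstar (cstar x) = x := by
  refine Completion.induction_on x (isClosed_eq (by fun_prop) (by fun_prop)) fun x => ?_
  simp only [cstar_coe, star_star]

theorem cstar_cmul (x y : Cpl b) : cstar (cmul x y) = cmul (cstar y) (cstar x) := by
  refine Completion.induction_on₂ x y (isClosed_eq (by fun_prop) (by fun_prop)) fun x y => ?_
  simp only [cmul_coe, cstar_coe, star_mul]

theorem cstar_add (x y : Cpl b) : cstar (x + y) = cstar x + cstar y := by
  refine Completion.induction_on₂ x y (isClosed_eq (by fun_prop) (by fun_prop)) fun x y => ?_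
  simp only [← Completion.coe_add, cstar_coe, star_add]

theorem cstar_smul (a : ℂ) (x : Cpl b) : cstar (a • x) = star a • cstar x := by
  refine Completion.induction_on x (isClosed_eq
    (continuous_cstar (continuous_id.const_smul a))
    ((continuous_cstar continuous_id).const_smul (star a))) fun x => ?_
  simp only [← Completion.coe_smul, cstar_coe, star_smul]

theorem norm_cmul_le (x y : Cpl b) : ‖cmul x y‖ ≤ ‖x‖ * ‖y‖ := by
  refine Completion.induction_on₂ x y (isClosed_le (by fun_prop) (by fun_prop)) fun x y => ?_
  simp only [cmul_coe, Completion.norm_coe]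
  exact norm_mul_le x y

theorem norm_cstar_cmul_self (x : Cpl b) : ‖x‖ * ‖x‖ ≤ ‖cmul (cstar x) x‖ := by
  refine Completion.induction_on x (isClosed_le (by fun_prop) (by fun_prop)) fun x => ?_
  simp only [cmul_coe, cstar_coe, Completion.norm_coe]
  exact (sq (‖x‖)).symm.le.trans ((isCStarSeminorm_max b).map_star_mul_self x).symm.le

instance : NonUnitalCStarAlgebra (CStarEnvelope b) :=
  { (inferInstance : NormedAddCommGroup (Cpl b)),
    (inferInstance : NormedSpace ℂ (Cpl b)),
    (inferInstance : CompleteSpace (Cpl b)) with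
    mul := cmul (b := b)
    star := cstar (b := b)
    zero_mul := zero_cmul (b := b)
    mul_zero := cmul_zero (b := b)
    mul_assoc := cmul_assoc (b := b)
    left_distrib := cmul_add (b := b)
    right_distrib := add_cmul (b := b)
    norm_mul_le := norm_cmul_le (b := b)
    star_involutive := cstar_cstar (b := b)
    star_mul := cstar_cmul (b := b)
    star_add := cstar_add (b := b)
    norm_mul_self_le := norm_cstar_cmul_self (b := b)
    smul_assoc := smul_cmul (b := b)
    smul_comm := fun a x y => (cmul_smul (b := b) a x y).symm
    star_smul := cstar_smul (b := b) }

/-- The canonical map of `X` into its enveloping C*-algebra, as a linear map. -/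
def ofL (b : X → ℝ) : X →ₗ[ℂ] CStarEnvelope b :=
  (Completion.toComplL (𝕜 := ℂ) (E := PreEnvelope b)).toLinearMap

theorem norm_ofL (x : X) : ‖ofL b x‖ = maxCStarSeminorm b x :=
  Completion.norm_coe (E := PreEnvelope b) x

theorem denseRange_ofL : DenseRange (ofL b) :=
  Completion.denseRange_coe (α := PreEnvelope b)

theorem ofL_mul (x y : X) : ofL b (x * y) = ofL b x * ofL b y :=
  (cmul_coe (b := b) x y).symm

theorem ofL_star (x : X) : ofL b (star x) = star (ofL b x) :=
  (cstar_coe (b := b) x).symm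

@[elab_as_elim]
theorem induction_on {P : CStarEnvelope b → Prop} (z : CStarEnvelope b)
    (hc : IsClosed {z | P z}) (h : ∀ x, P (ofL b x)) : P z :=
  denseRange_ofL.induction_on z hc h

@[elab_as_elim]
theorem induction_on₂ {P : CStarEnvelope b → CStarEnvelope b → Prop} (z w : CStarEnvelope b)
    (hc : IsClosed {z : CStarEnvelope b × CStarEnvelope b | P z.1 z.2})
    (h : ∀ x y, P (ofL b x) (ofL b y)) : P z w :=
  denseRange_ofL.induction_on₂ hc h z w

variable (b) in
/-- The canonical *-homomorphism of `X` into its enveloping C*-algebra. -/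
def of : X →⋆ₙₐ[ℂ] CStarEnvelope b :=
  { ofL b with
    map_zero' := map_zero (ofL b)
    map_mul' := ofL_mul
    map_star' := ofL_star }

theorem of_apply (x : X) : of b x = ofL b x := rfl

variable {c} in
theorem maxCStarSeminorm_map_le (f : X →⋆ₙₐ[ℂ] Y) (hf : ∀ x, c (f x) ≤ b x) (x : X) :
    maxCStarSeminorm c (f x) ≤ maxCStarSeminorm b x := by
  refine maxCStarSeminorm_le (apply_nonneg _ _) fun p hp hc => ?_
  let q : Seminorm ℂ X := p.comp (f : X →ₗ[ℂ] Y)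
  have hq : IsCStarSeminorm q :=
    { map_mul_le := fun x y => by
        change p (f (x * y)) ≤ p (f x) * p (f y)
        rw [map_mul]; exact hp.map_mul_le _ _
      map_star_mul_self := fun x => by
        change p (f (star x * x)) = p (f x) ^ 2
        rw [map_mul, map_star f]; exact hp.map_star_mul_self _ }
  exact le_maxCStarSeminorm hq (fun y => (hc _).trans (hf y)) x

/-- The continuous linear extension underlying `CStarEnvelope.map`. -/
def mapL (f : X →⋆ₙₐ[ℂ] Y) (hf : ∀ x, c (f x) ≤ b x) :
    CStarEnvelope b →L[ℂ] CStarEnvelope c :=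
  ContinuousLinearMap.completion
    (LinearMap.mkContinuous (E := PreEnvelope b) (F := PreEnvelope c)
      (f : X →ₗ[ℂ] Y) 1 fun x => by
        rw [one_mul]; exact maxCStarSeminorm_map_le f hf x)

variable {c}

theorem mapL_ofL (f : X →⋆ₙₐ[ℂ] Y) (hf : ∀ x, c (f x) ≤ b x) (x : X) :
    mapL c f hf (ofL b x) = ofL c (f x) :=
  ContinuousLinearMap.completion_apply_coe _ _

/-- The *-homomorphism of enveloping C*-algebras which extends a *-homomorphism `f : X → Y`
that does not increase the dominating functions. -/
def map (f : X →⋆ₙₐ[ℂ] Y) (hf : ∀ x, c (f x) ≤ b x) :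
    CStarEnvelope b →⋆ₙₐ[ℂ] CStarEnvelope c :=
  { (mapL c f hf).toLinearMap with
    map_zero' := map_zero (mapL c f hf)
    map_mul' := fun x y => by
      change mapL c f hf (x * y) = mapL c f hf x * mapL c f hf y
      refine induction_on₂ x y (isClosed_eq (by fun_prop) (by fun_prop)) fun x y => ?_
      simp only [← ofL_mul, mapL_ofL, map_mul]
    map_star' := fun x => by
      change mapL c f hf (star x) = star (mapL c f hf x)
      refine induction_on x (isClosed_eq (by fun_prop) (by fun_prop)) fun x => ?_
      simp only [← ofL_star, mapL_ofL, map_star f] }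

theorem map_of (f : X →⋆ₙₐ[ℂ] Y) (hf : ∀ x, c (f x) ≤ b x) (x : X) :
    map f hf (of b x) = of c (f x) :=
  mapL_ofL f hf x

end CStarEnvelope
end Envelope

/-! ### Compact operators and tensor products -/

section CompactOperators

variable {H : Type*} [NormedAddCommGroup H] [InnerProductSpace ℂ H] [CompleteSpace H]

theorem isCompactOperator_star {T : H →L[ℂ] H} (hT : IsCompactOperator T) :
    IsCompactOperator (star T : H →L[ℂ] H) := by
  have hc : IsCompactOperator ((T * star T : H →L[ℂ] H) : H →ₗ[ℂ] H) := hT.comp_clm (star T)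
  have h1 := (hc.isCompact_closure_image_closedBall 1).totallyBounded.subset subset_closure
  refine (isCompactOperator_iff_isCompact_closure_image_closedBall
    ((star T : H →L[ℂ] H) : H →ₗ[ℂ] H) one_pos).mpr ?_
  refine TotallyBounded.isCompact_of_isClosed ?_ isClosed_closure
  refine TotallyBounded.closure ?_
  rw [Metric.totallyBounded_iff]
  intro ε hε
  obtain ⟨t, hts, htf, htc⟩ := Metric.finite_approx_of_totallyBounded h1 (ε ^ 2 / 2) (by positivity)
  obtain ⟨t', ht's, ht'f, rfl⟩ := Set.exists_subset_image_finite_and.mp ⟨t, hts, htf, rfl⟩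
  refine ⟨(star T : H →L[ℂ] H) '' t', ht'f.image _, ?_⟩
  rintro _ ⟨x, hx, rfl⟩
  obtain ⟨_, ⟨y, hy, rfl⟩, hxy⟩ := Set.mem_iUnion₂.mp (htc ⟨x, hx, rfl⟩)
  refine Set.mem_iUnion₂.mpr ⟨_, ⟨y, hy, rfl⟩, ?_⟩
  rw [Metric.mem_ball, dist_eq_norm] at hxy ⊢
  have hn : ‖x - y‖ ≤ 2 := by
    have hx' : ‖x‖ ≤ 1 := by simpa using hx
    have hy' : ‖y‖ ≤ 1 := by simpa using ht's hy
    linarith [norm_sub_le x y]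
  change ‖(star T) x - (star T) y‖ < ε
  change ‖T ((star T) x) - T ((star T) y)‖ < ε ^ 2 / 2 at hxy
  rw [← map_sub] at hxy ⊢
  rw [← map_sub] at hxy
  have key : ‖(star T) (x - y)‖ ^ 2 ≤ ‖T ((star T) (x - y))‖ * ‖x - y‖ := by
    have h2 : inner ℂ ((star T) (x - y)) ((star T) (x - y)) =
        inner ℂ (T ((star T) (x - y))) (x - y) := by
      rw [ContinuousLinearMap.star_eq_adjoint, ContinuousLinearMap.adjoint_inner_right]
    calc ‖(star T) (x - y)‖ ^ 2
        = ‖inner ℂ ((star T) (x - y)) ((star T) (x - y))‖ := by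
          rw [inner_self_eq_norm_sq_to_K]; simp
      _ ≤ _ := by rw [h2]; exact norm_inner_le_norm _ _
  have h3 : ‖(star T) (x - y)‖ ^ 2 < ε ^ 2 := by
    nlinarith [norm_nonneg (T ((star T) (x - y))), norm_nonneg (x - y)]
  exact lt_of_pow_lt_pow_left₀ 2 hε.le h3

variable (H) in
/-- The C*-algebra `𝒦(H)` of compact operators on the Hilbert space `H`. -/
def compactOperators : NonUnitalStarSubalgebra ℂ (H →L[ℂ] H) where
  carrier := {T | IsCompactOperator T}
  zero_mem' := isCompactOperator_zero
  add_mem' := fun h1 h2 => IsCompactOperator.add h1 h2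
  mul_mem' := fun {_ S} h1 _ => IsCompactOperator.comp_clm h1 S
  smul_mem' := fun a _ h => IsCompactOperator.smul h a
  star_mem' := fun h => isCompactOperator_star h

instance : IsClosed (compactOperators H : Set (H →L[ℂ] H)) :=
  isClosed_setOfPred_isCompactOperator

end CompactOperators

section Tensor

variable (A B C : Type*) [NonUnitalCStarAlgebra A] [NonUnitalCStarAlgebra B]
  [NonUnitalCStarAlgebra C]

/-- The projective tensor norm on the algebraic tensor product. -/
def projectiveNorm (t : A ⊗[ℂ] B) : ℝ :=
  sInf {r | ∃ l : List (A × B), (l.map fun x => x.1 ⊗ₜ[ℂ] x.2).sum = t ∧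
    (l.map fun x => ‖x.1‖ * ‖x.2‖).sum = r}

/-- The C*-tensor product `A ⊗ B`: the completion of the algebraic tensor product with respect to
the greatest C*-seminorm on it. (Every C*-seminorm `p` on the algebraic tensor product satisfies
`p (a ⊗ b) ≤ ‖a‖ * ‖b‖`, that is, it is dominated by the projective norm.) In this development
`B` is the nuclear C*-algebra of compact operators on a Hilbert space, for which there is only one
C*-norm on the algebraic tensor product. -/
abbrev CStarTensor : Type _ := CStarEnvelope (projectiveNorm A B)

variable {A B}

/-- `φ ⊗ id` on algebraic tensor products. -/
def algTensorMap (φ : A →⋆ₙₐ[ℂ] B) : (A ⊗[ℂ] C) →⋆ₙₐ[ℂ] (B ⊗[ℂ] C) :=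
  { TensorProduct.map (φ : A →ₗ[ℂ] B) (LinearMap.id : C →ₗ[ℂ] C) with
    map_zero' := map_zero _
    map_mul' := fun x y => by
      change TensorProduct.map (φ : A →ₗ[ℂ] B) LinearMap.id (x * y) =
        TensorProduct.map (φ : A →ₗ[ℂ] B) LinearMap.id x *
          TensorProduct.map (φ : A →ₗ[ℂ] B) LinearMap.id y
      induction x using TensorProduct.induction_on with
      | zero => simp
      | add x₁ x₂ h₁ h₂ => simp only [add_mul, map_add, h₁, h₂]
      | tmul a c =>
        induction y using TensorProduct.induction_on with
        | zero => simp
        | add y₁ y₂ h₁ h₂ => simp only [mul_add, map_add, h₁, h₂]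
        | tmul a' c' => simp
    map_star' := fun x => by
      change TensorProduct.map (φ : A →ₗ[ℂ] B) LinearMap.id (star x) =
        star (TensorProduct.map (φ : A →ₗ[ℂ] B) LinearMap.id x)
      induction x using TensorProduct.induction_on with
      | zero => simp
      | add x₁ x₂ h₁ h₂ => simp only [star_add, map_add, h₁, h₂]
      | tmul a c => simp [map_star φ] }

variable {C}

theorem algTensorMap_tmul (φ : A →⋆ₙₐ[ℂ] B) (a : A) (k : C) :
    algTensorMap C φ (a ⊗ₜ k) = φ a ⊗ₜ k := rfl

theorem projectiveNorm_algTensorMap_le (φ : A →⋆ₙₐ[ℂ] B) (t : A ⊗[ℂ] C) :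
    projectiveNorm B C (algTensorMap C φ t) ≤ projectiveNorm A C t := by
  have hne : ∀ t : A ⊗[ℂ] C, ∃ l : List (A × C), (l.map fun x => x.1 ⊗ₜ[ℂ] x.2).sum = t := by
    intro t
    induction t using TensorProduct.induction_on with
    | zero => exact ⟨[], rfl⟩
    | tmul a c => exact ⟨[(a, c)], by simp⟩
    | add x y hx hy =>
      obtain ⟨l, rfl⟩ := hx
      obtain ⟨m, rfl⟩ := hy
      exact ⟨l ++ m, by simp⟩
  obtain ⟨l₀, hl₀⟩ := hne t
  refine le_csInf ⟨_, l₀, hl₀, rfl⟩ ?_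
  rintro _ ⟨l, rfl, rfl⟩
  have hmap : algTensorMap C φ (l.map fun x => x.1 ⊗ₜ[ℂ] x.2).sum =
      ((l.map fun x => (φ x.1, x.2)).map fun x => x.1 ⊗ₜ[ℂ] x.2).sum := by
    rw [map_list_sum, List.map_map, List.map_map]
    rfl
  have hle : ((l.map fun x => (φ x.1, x.2)).map fun x => ‖x.1‖ * ‖x.2‖).sum ≤
      (l.map fun x => ‖x.1‖ * ‖x.2‖).sum := by
    rw [List.map_map]
    refine List.sum_le_sum fun x _ => ?_
    exact mul_le_mul_of_nonneg_right (NonUnitalStarAlgHom.norm_apply_le φ x.1) (norm_nonneg _)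
  refine le_trans (csInf_le ⟨0, ?_⟩ ⟨_, hmap.symm, rfl⟩) hle
  rintro _ ⟨m, -, rfl⟩
  refine List.sum_nonneg fun r hr => ?_
  obtain ⟨x, -, rfl⟩ := List.mem_map.mp hr
  positivity

variable (C) in
/-- The *-homomorphism `φ ⊗ id : A ⊗ C → B ⊗ C`. -/
def CStarTensor.map (φ : A →⋆ₙₐ[ℂ] B) : CStarTensor A C →⋆ₙₐ[ℂ] CStarTensor B C :=
  CStarEnvelope.map (algTensorMap C φ) (projectiveNorm_algTensorMap_le φ)

end Tensor

/-! ### Circle actions and their crossed products -/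

instance : MeasurableSpace Circle := borel Circle

instance : BorelSpace Circle := ⟨rfl⟩

/-- The normalized Haar measure on the circle group. -/
def circleHaar : Measure Circle := Measure.haarMeasure ⊤

instance : circleHaar.IsHaarMeasure := by unfold circleHaar; infer_instance

instance : IsProbabilityMeasure circleHaar :=
  ⟨Measure.haarMeasure_self (G := Circle) (K₀ := ⊤)⟩

/-- The Hilbert space `L²(𝕋)`. -/
abbrev L2Circle : Type := Lp ℂ 2 circleHaar

/-- A continuous action of the circle on the C*-algebra `A`. -/
structure CircleAction (A : Type*) [CStarAlgebra A] where
  toHom : Circle →* (A ≃⋆ₐ[ℂ] A)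
  continuous_apply : ∀ a, Continuous fun ζ => toHom ζ a

namespace CircleAction

variable {A B : Type*} [CStarAlgebra A] [CStarAlgebra B]

instance : CoeFun (CircleAction A) fun _ => Circle → A ≃⋆ₐ[ℂ] A := ⟨fun α => α.toHom⟩

variable (α : CircleAction A) (β : CircleAction B)

theorem mul_apply (ζ η : Circle) (a : A) : α (ζ * η) a = α ζ (α η a) := by
  rw [map_mul, StarAlgEquiv.mul_apply]

theorem one_apply (a : A) : α 1 a = a := by
  rw [_root_.map_one, StarAlgEquiv.one_apply]

/-- The Rokhlin property. -/
def HasRokhlinProperty : Prop :=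
  ∀ ε : ℝ, 0 < ε → ∀ F : Finset A, ∃ u ∈ unitary A,
    (∀ ζ : Circle, ‖α ζ u - (ζ : ℂ) • u‖ < ε) ∧ ∀ a ∈ F, ‖u * a - a * u‖ < ε

/-- The unitaries `u` of `A` with `α_ζ(u) = ζ u` for all `ζ`. -/
def eigenunitaries : Set A :=
  {u | u ∈ unitary A ∧ ∀ ζ : Circle, α ζ u = (ζ : ℂ) • u}

/-- The fixed point algebra `A^α`. -/
def fixedPoints : StarSubalgebra ℂ A where
  carrier := {a | ∀ ζ, α ζ a = a}
  mul_mem' := fun ha hb ζ => by rw [map_mul, ha ζ, hb ζ]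
  add_mem' := fun ha hb ζ => by rw [map_add, ha ζ, hb ζ]
  algebraMap_mem' := fun r ζ => by rw [Algebra.algebraMap_eq_smul_one, map_smul, _root_.map_one]
  star_mem' := fun ha ζ => by rw [map_star, ha ζ]

instance : IsClosed (α.fixedPoints : Set A) := by
  have : (α.fixedPoints : Set A) = ⋂ ζ, {a | α ζ a = a} := by
    ext a; simp [fixedPoints]
  rw [this]
  exact isClosed_iInter fun ζ => isClosed_eq (StarAlgEquiv.isometry (α ζ)).continuous continuous_id

/-- Equivariance of a unital *-homomorphism. -/
def IsEquivariant (φ : A →⋆ₐ[ℂ] B) : Prop := ∀ ζ a, φ (α ζ a) = β ζ (φ a)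

variable {α β} in
/-- The restriction of an equivariant *-homomorphism to the fixed point algebras. -/
def fixedPointsMap (φ : A →⋆ₐ[ℂ] B) (hφ : α.IsEquivariant β φ) :
    α.fixedPoints →⋆ₙₐ[ℂ] β.fixedPoints where
  toFun a := ⟨φ a, fun ζ => by rw [← hφ, a.2 ζ]⟩
  map_smul' r a := Subtype.ext (map_smul φ r (a : A))
  map_zero' := Subtype.ext (map_zero φ)
  map_add' a b := Subtype.ext (map_add φ (a : A) b)
  map_mul' a b := Subtype.ext (map_mul φ (a : A) b)
  map_star' a := Subtype.ext (map_star φ (a : A))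

theorem continuous_uncurry : Continuous fun p : Circle × A => α p.1 p.2 :=
  continuous_prod_of_continuous_lipschitzWith' _ 1
    (fun ζ => (StarAlgEquiv.isometry (α ζ)).lipschitz) α.continuous_apply

@[fun_prop]
theorem continuous_act {T : Type*} [TopologicalSpace T] {f : T → Circle} {g : T → A}
    (hf : Continuous f) (hg : Continuous g) : Continuous fun t => α (f t) (g t) :=
  α.continuous_uncurry.comp (hf.prodMk hg)

/-- `α_ζ` as a continuous linear map. -/
def clm (ζ : Circle) : A →L[ℂ] A where
  toFun := α ζ
  map_add' := map_add _
  map_smul' := map_smul _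
  cont := (StarAlgEquiv.isometry (α ζ)).continuous

theorem act_integral (ζ : Circle) {f : Circle → A} (hf : Integrable f circleHaar) :
    α ζ (∫ s, f s ∂circleHaar) = ∫ s, α ζ (f s) ∂circleHaar :=
  ((α.clm ζ).integral_comp_comm hf).symm

end CircleAction

section Convolution

variable {A B : Type*} [CStarAlgebra A] [CStarAlgebra B]

theorem integrable_circle {E : Type*} [NormedAddCommGroup E] {f : Circle → E}
    (hf : Continuous f) : Integrable f circleHaar :=
  hf.integrable_of_hasCompactSupport (HasCompactSupport.of_compactSpace f)

theorem integrable_circle_prod {E : Type*} [NormedAddCommGroup E] {f : Circle × Circle → E}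
    (hf : Continuous f) : Integrable f (circleHaar.prod circleHaar) :=
  hf.integrable_of_hasCompactSupport (HasCompactSupport.of_compactSpace f)

theorem continuous_circle_integral {T E : Type*} [TopologicalSpace T] [FirstCountableTopology T]
    [LocallyCompactSpace T] [NormedAddCommGroup E] [NormedSpace ℝ E] {f : T → Circle → E}
    (hf : Continuous f.uncurry) : Continuous fun t => ∫ s, f t s ∂circleHaar := by
  simpa using continuous_parametric_integral_of_continuous (μ := circleHaar) hf isCompact_univ

/-- The convolution *-algebra `C(𝕋, A)` of the action `α`:
`(f * g)(t) = ∫ f(s) α_s(g(s⁻¹ t)) ds` and `f*(t) = α_t(f(t⁻¹)*)`. -/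
def ConvAlgebra (_α : CircleAction A) : Type _ := C(Circle, A)

namespace ConvAlgebra

variable (α : CircleAction A) {β : CircleAction B}

instance : AddCommGroup (ConvAlgebra α) := inferInstanceAs (AddCommGroup C(Circle, A))
instance : Module ℂ (ConvAlgebra α) := inferInstanceAs (Module ℂ C(Circle, A))
instance : FunLike (ConvAlgebra α) Circle A := inferInstanceAs (FunLike C(Circle, A) Circle A)
instance : ContinuousMapClass (ConvAlgebra α) Circle A :=
  inferInstanceAs (ContinuousMapClass C(Circle, A) Circle A)

variable {α}

@[ext] theorem ext {f g : ConvAlgebra α} (h : ∀ t, f t = g t) : f = g := DFunLike.ext _ _ h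

@[simp] theorem add_apply (f g : ConvAlgebra α) (t : Circle) : (f + g) t = f t + g t := rfl
@[simp] theorem zero_apply (t : Circle) : (0 : ConvAlgebra α) t = 0 := rfl
@[simp] theorem smul_apply (r : ℂ) (f : ConvAlgebra α) (t : Circle) : (r • f) t = r • f t := rfl

@[fun_prop]
theorem continuous_eval {T : Type*} [TopologicalSpace T] (f : ConvAlgebra α) {g : T → Circle}
    (hg : Continuous g) : Continuous fun t => f (g t) :=
  (map_continuous f).comp hg

instance : Mul (ConvAlgebra α) where
  mul f g :=
    { toFun := fun t => ∫ s, f s * α s (g (s⁻¹ * t)) ∂circleHaar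
      continuous_toFun := continuous_circle_integral (by unfold Function.uncurry; fun_prop) }

instance : Star (ConvAlgebra α) where
  star f :=
    { toFun := fun t => α t (star (f t⁻¹))
      continuous_toFun := by fun_prop }

theorem mul_apply (f g : ConvAlgebra α) (t : Circle) :
    (f * g) t = ∫ s, f s * α s (g (s⁻¹ * t)) ∂circleHaar := rfl

theorem star_apply (f : ConvAlgebra α) (t : Circle) : star f t = α t (star (f t⁻¹)) := rfl

theorem mul_assoc' (f g h : ConvAlgebra α) : f * g * h = f * (g * h) := by
  ext t
  calc (f * g * h) t
      = ∫ s, (∫ r, f r * α r (g (r⁻¹ * s)) ∂circleHaar) * α s (h (s⁻¹ * t)) ∂circleHaar := rfl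
    _ = ∫ s, (∫ r, f r * α r (g (r⁻¹ * s)) * α s (h (s⁻¹ * t)) ∂circleHaar) ∂circleHaar := by
        congr 1 with s
        rw [integral_mul_const_of_integrable (integrable_circle (by fun_prop))]
    _ = ∫ r, (∫ s, f r * α r (g (r⁻¹ * s)) * α s (h (s⁻¹ * t)) ∂circleHaar) ∂circleHaar :=
        integral_integral_swap (integrable_circle_prod (by unfold Function.uncurry; fun_prop))
    _ = ∫ r, (∫ s, f r * α r (g s * α s (h (s⁻¹ * (r⁻¹ * t)))) ∂circleHaar) ∂circleHaar := by
        congr 1 with r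
        rw [← integral_mul_left_eq_self _ r]
        congr 1 with s
        rw [inv_mul_cancel_left, map_mul (α r), ← α.mul_apply, mul_inv_rev, mul_assoc, mul_assoc]
    _ = ∫ r, f r * α r (∫ s, g s * α s (h (s⁻¹ * (r⁻¹ * t))) ∂circleHaar) ∂circleHaar := by
        congr 1 with r
        rw [α.act_integral r (integrable_circle (by fun_prop)),
          integral_const_mul_of_integrable (integrable_circle (by fun_prop))]

theorem star_mul' (f g : ConvAlgebra α) : star (f * g) = star g * star f := by
  ext t
  calc star (f * g) t
      = α t (star (∫ s, f s * α s (g (s⁻¹ * t⁻¹)) ∂circleHaar)) := rfl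
    _ = ∫ s, α t (star (f s * α s (g (s⁻¹ * t⁻¹)))) ∂circleHaar := by
        have h := ((starL' ℝ : A ≃L[ℝ] A) : A →L[ℝ] A).integral_comp_comm
          (μ := circleHaar) (φ := fun s => f s * α s (g (s⁻¹ * t⁻¹)))
          (integrable_circle (by fun_prop))
        rw [← α.act_integral t (integrable_circle (by fun_prop))]
        exact congrArg (α t) h.symm
    _ = ∫ s, α s (star (g s⁻¹)) * α s (α (s⁻¹ * t) (star (f (s⁻¹ * t)⁻¹))) ∂circleHaar := by
        rw [← integral_mul_left_eq_self _ t⁻¹]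
        congr 1 with s
        rw [star_mul, map_mul, ← map_star, ← α.mul_apply, ← α.mul_apply]
        simp only [mul_inv_rev, inv_inv, mul_inv_cancel_left, mul_assoc, mul_inv_cancel, mul_one]
    _ = (star g * star f) t := rfl

instance : NonUnitalRing (ConvAlgebra α) :=
  { (inferInstance : AddCommGroup (ConvAlgebra α)), (inferInstance : Mul (ConvAlgebra α)) with
    zero_mul := fun f => by ext t; simp [mul_apply]
    mul_zero := fun f => by ext t; simp [mul_apply]
    mul_assoc := mul_assoc'
    left_distrib := fun f g h => by
      ext t
      simp only [mul_apply, add_apply, map_add, mul_add]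
      exact integral_add (integrable_circle (by fun_prop)) (integrable_circle (by fun_prop))
    right_distrib := fun f g h => by
      ext t
      simp only [mul_apply, add_apply, add_mul]
      exact integral_add (integrable_circle (by fun_prop)) (integrable_circle (by fun_prop)) }

instance : StarRing (ConvAlgebra α) where
  star_involutive f := by
    ext t
    rw [star_apply, star_apply, ← map_star, ← α.mul_apply, mul_inv_cancel, α.one_apply, star_star,
      inv_inv]
  star_mul := star_mul'
  star_add f g := by
    ext t
    simp [star_apply]

instance : IsScalarTower ℂ (ConvAlgebra α) (ConvAlgebra α) where
  smul_assoc r f g := by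
    ext t
    simp only [smul_eq_mul, mul_apply, smul_apply, smul_mul_assoc]
    exact integral_smul r _

instance : SMulCommClass ℂ (ConvAlgebra α) (ConvAlgebra α) where
  smul_comm r f g := by
    ext t
    simp only [smul_eq_mul, mul_apply, smul_apply, map_smul, mul_smul_comm]
    exact (integral_smul r _).symm

instance : StarModule ℂ (ConvAlgebra α) where
  star_smul r f := by
    ext t
    simp [star_apply]

/-- The `L¹`-norm. -/
def l1Norm (α : CircleAction A) (f : ConvAlgebra α) : ℝ := ∫ t, ‖f t‖ ∂circleHaar

theorem continuous_hom (φ : A →⋆ₐ[ℂ] B) : Continuous φ :=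
  AddMonoidHomClass.continuous_of_bound φ 1 fun a => by
    rw [one_mul]; exact NonUnitalStarAlgHom.norm_apply_le φ a

/-- Composition of a function with a *-homomorphism. -/
def mapFun (φ : A →⋆ₐ[ℂ] B) (f : ConvAlgebra α) : ConvAlgebra β where
  toFun t := φ (f t)
  continuous_toFun := (continuous_hom φ).comp (map_continuous f)

theorem mapFun_apply (φ : A →⋆ₐ[ℂ] B) (f : ConvAlgebra α) (t : Circle) :
    (mapFun φ f : ConvAlgebra β) t = φ (f t) := rfl

theorem mapFun_mul (φ : A →⋆ₐ[ℂ] B) (hφ : α.IsEquivariant β φ) (f g : ConvAlgebra α) :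
    (mapFun φ (f * g) : ConvAlgebra β) = mapFun φ f * mapFun φ g := by
  ext t
  let L : A →L[ℂ] B := ⟨(φ : A →ₗ[ℂ] B), continuous_hom φ⟩
  have h := L.integral_comp_comm (μ := circleHaar) (φ := fun s => f s * α s (g (s⁻¹ * t)))
    (integrable_circle (by fun_prop))
  refine Eq.trans (b := ∫ s, L (f s * α s (g (s⁻¹ * t))) ∂circleHaar) h.symm ?_
  rw [mul_apply]
  congr 1 with s
  rw [mapFun_apply, mapFun_apply, ← hφ, ← map_mul]
  rfl

theorem mapFun_star (φ : A →⋆ₐ[ℂ] B) (hφ : α.IsEquivariant β φ) (f : ConvAlgebra α) :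
    (mapFun φ (star f) : ConvAlgebra β) = star (mapFun φ f) := by
  ext t
  rw [mapFun_apply, star_apply, star_apply, mapFun_apply, hφ, map_star φ]

/-- Composition with an equivariant *-homomorphism, as a *-homomorphism of convolution algebras. -/
def map (φ : A →⋆ₐ[ℂ] B) (hφ : α.IsEquivariant β φ) : ConvAlgebra α →⋆ₙₐ[ℂ] ConvAlgebra β where
  toFun := mapFun φ
  map_smul' r f := by ext t; exact map_smul φ r (f t)
  map_zero' := by ext t; exact map_zero φ
  map_add' f g := by ext t; exact map_add φ (f t) (g t)
  map_mul' := mapFun_mul φ hφ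
  map_star' := mapFun_star φ hφ

theorem map_apply (φ : A →⋆ₐ[ℂ] B) (hφ : α.IsEquivariant β φ) (f : ConvAlgebra α) (t : Circle) :
    map φ hφ f t = φ (f t) := rfl

theorem l1Norm_map_le (φ : A →⋆ₐ[ℂ] B) (hφ : α.IsEquivariant β φ) (f : ConvAlgebra α) :
    l1Norm β (map φ hφ f) ≤ l1Norm α f :=
  integral_mono (integrable_circle (by fun_prop)) (integrable_circle (by fun_prop))
    fun t => NonUnitalStarAlgHom.norm_apply_le φ (f t)

end ConvAlgebra

/-- The (full) crossed product `A ⋊_α 𝕋`: the enveloping C*-algebra of `L¹(𝕋, A)`, obtained as the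
completion of its dense *-subalgebra `C(𝕋, A)` in the greatest C*-seminorm dominated by the
`L¹`-norm. -/
abbrev CrossedProduct (α : CircleAction A) : Type _ := CStarEnvelope (ConvAlgebra.l1Norm α)

/-- The *-homomorphism `φ ⋊ 𝕋 : A ⋊_α 𝕋 → B ⋊_β 𝕋` induced by an equivariant *-homomorphism. -/
def CrossedProduct.map {α : CircleAction A} {β : CircleAction B} (φ : A →⋆ₐ[ℂ] B)
    (hφ : α.IsEquivariant β φ) : CrossedProduct α →⋆ₙₐ[ℂ] CrossedProduct β :=
  CStarEnvelope.map (ConvAlgebra.map φ hφ) (ConvAlgebra.l1Norm_map_le φ hφ)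

end Convolution

end CircleRokhlin

end

universe u

/-!
Let `u` be an eigenunitary. In the convolution algebra `C(𝕋, A)` the functions `t ↦ tʲ u⁻ⁱ d uʲ`,
for `d ∈ A^α` and `i j : ℤ`, multiply like the matrix units `d ⊗ eᵢⱼ`, so the two families span
isomorphic *-algebras, which are dense in `A ⋊_α 𝕋` and in `A^α ⊗ 𝒦(H)`. On the matrices supported
in a fixed finite set of indices, the `L¹`-norm and the projective norm are equivalent. A
C*-seminorm which is bounded by a multiple of a submultiplicative *-seminorm `b` is already bounded
by `b`, as one sees by applying the bound to powers of `x* x`. Hence the greatest C*-seminorms below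
the two norms agree on the common dense *-algebra, and their completions are isomorphic.

An exact eigenunitary is obtained from an approximate one by averaging `ζ ↦ ζ α_ζ⁻¹(w)` over the
circle, which gives an invertible eigenvector, and passing to its polar decomposition.
-/

noncomputable section

namespace CircleRokhlin

open Filter Topology

/-! ### Comparison and extension of C*-seminorms -/

section SeminormComparison

variable {X Y : Type*} [NonUnitalRing X] [StarRing X] [Module ℂ X]
  [NonUnitalRing Y] [StarRing Y] [Module ℂ Y]

/-- A submultiplicative seminorm with isometric involution: the kind of seminorm with respect to
which enveloping C*-algebras are formed. -/
structure IsStarAlgebraSeminorm (q : Seminorm ℂ X) : Prop where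
  map_mul_le : ∀ x y, q (x * y) ≤ q x * q y
  map_star : ∀ x, q (star x) = q x

theorem IsStarAlgebraSeminorm.comp {q : Seminorm ℂ Y} (hq : IsStarAlgebraSeminorm q)
    (f : X →⋆ₙₐ[ℂ] Y) : IsStarAlgebraSeminorm (q.comp (f : X →ₗ[ℂ] Y)) where
  map_mul_le x y := by simpa using hq.map_mul_le (f x) (f y)
  map_star x := by simpa [StarHomClass.map_star f] using hq.map_star (f x)

theorem le_of_forall_pow_two_pow_le_mul {a c C : ℝ} (hc : 0 ≤ c)
    (h : ∀ k : ℕ, a ^ 2 ^ k ≤ C * c ^ 2 ^ k) : a ≤ c := by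
  by_contra! hca
  rcases hc.eq_or_lt with rfl | hc
  · have ha : a ≤ 0 := by simpa using h 0
    exact hca.not_ge ha
  · have hr : 1 < a / c := (one_lt_div hc).mpr hca
    obtain ⟨n, hn⟩ := pow_unbounded_of_one_lt C hr
    refine hn.not_ge ?_
    calc (a / c) ^ n ≤ (a / c) ^ 2 ^ n := pow_le_pow_right₀ hr.le n.lt_two_pow_self.le
      _ ≤ C := by rw [div_pow, div_le_iff₀ (by positivity)]; exact h n

theorem IsCStarSeminorm.map_iterate_mul_self {p : Seminorm ℂ X} (hp : IsCStarSeminorm p) {z : X}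
    (hz : IsSelfAdjoint z) (k : ℕ) : p ((fun y => y * y)^[k] z) = p z ^ 2 ^ k := by
  induction k generalizing z with
  | zero => simp
  | succ k ih =>
    have hzz : p (z * z) = p z ^ 2 := by simpa only [hz.star_eq] using hp.map_star_mul_self z
    rw [Function.iterate_succ_apply, ih (hz.commute_iff hz |>.mp (.refl z)), hzz, ← pow_mul,
      pow_succ']

theorem IsStarAlgebraSeminorm.map_iterate_mul_self_le {q : Seminorm ℂ X}
    (hq : IsStarAlgebraSeminorm q) (z : X) (k : ℕ) :
    q ((fun y => y * y)^[k] z) ≤ q z ^ 2 ^ k := by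
  induction k generalizing z with
  | zero => simp
  | succ k ih =>
    calc q ((fun y => y * y)^[k] (z * z)) ≤ q (z * z) ^ 2 ^ k := ih _
      _ ≤ (q z * q z) ^ 2 ^ k := by gcongr; exact hq.map_mul_le z z
      _ = q z ^ 2 ^ (k + 1) := by rw [← sq, ← pow_mul, pow_succ']

/- For self-adjoint `z` one has `p z ^ n = p (z ^ n) ≤ C * q (z ^ n) ≤ C * q z ^ n` for every power
`n` of two, and the constant disappears after taking roots. -/
theorem IsCStarSeminorm.le_of_le_const_mul {p q : Seminorm ℂ X} (hp : IsCStarSeminorm p)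
    (hq : IsStarAlgebraSeminorm q) {T : NonUnitalStarSubalgebra ℂ X} {C : ℝ} (hC : 0 ≤ C)
    (h : ∀ x ∈ T, p x ≤ C * q x) {x : X} (hx : x ∈ T) : p x ≤ q x := by
  have le_of_isSelfAdjoint {z : X} (hz : IsSelfAdjoint z) (hzT : z ∈ T) : p z ≤ q z := by
    refine le_of_forall_pow_two_pow_le_mul (C := C) (apply_nonneg q z) fun k => ?_
    have hmem : (fun y => y * y)^[k] z ∈ T :=
      Set.MapsTo.iterate (s := (T : Set X)) (fun _ hy => mul_mem hy hy) k hzT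
    calc p z ^ 2 ^ k = p ((fun y => y * y)^[k] z) := (hp.map_iterate_mul_self hz k).symm
      _ ≤ C * q ((fun y => y * y)^[k] z) := h _ hmem
      _ ≤ C * q z ^ 2 ^ k := by gcongr; exact hq.map_iterate_mul_self_le z k
  refine (pow_le_pow_iff_left₀ (apply_nonneg p x) (apply_nonneg q x) two_ne_zero).mp ?_
  calc p x ^ 2 = p (star x * x) := (hp.map_star_mul_self x).symm
    _ ≤ q (star x * x) := le_of_isSelfAdjoint (.star_mul_self x) (mul_mem (star_mem hx) hx)
    _ ≤ q (star x) * q x := hq.map_mul_le _ _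
    _ = q x ^ 2 := by rw [hq.map_star, sq]

end SeminormComparison

section SeminormExtension

variable {W X V : Type*} [AddCommGroup W] [Module ℂ W] [AddCommGroup X] [Module ℂ X]

/-- The greatest seminorm on `X` which is dominated by `b`, and by `p` along `f`. If `f` has dense
range and `p ≤ b ∘ f`, it is the extension of `p` by continuity. -/
def infSeminorm (b : Seminorm ℂ X) (f : W →ₗ[ℂ] X) (p : Seminorm ℂ W) : Seminorm ℂ X :=
  Seminorm.ofSMulLE (fun x => ⨅ w, (p w + b (x - f w)))
    (le_antisymm (ciInf_le_of_le ⟨0, by rintro _ ⟨w, rfl⟩; positivity⟩ 0 (by simp))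
      (Real.iInf_nonneg fun w => by positivity))
    (fun x y => by
      refine le_ciInf_add_ciInf fun v w =>
        ciInf_le_of_le ⟨0, by rintro _ ⟨w, rfl⟩; positivity⟩ (v + w) ?_
      calc p (v + w) + b (x + y - f (v + w))
          = p (v + w) + b ((x - f v) + (y - f w)) := by rw [map_add f, add_sub_add_comm]
        _ ≤ (p v + p w) + (b (x - f v) + b (y - f w)) :=
          add_le_add (map_add_le_add p v w) (map_add_le_add b _ _)
        _ = (p v + b (x - f v)) + (p w + b (y - f w)) := add_add_add_comm _ _ _ _)
    (fun r x => by
      rw [Real.mul_iInf_of_nonneg (norm_nonneg r)]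
      refine le_ciInf fun w => ciInf_le_of_le ⟨0, by rintro _ ⟨w, rfl⟩; positivity⟩ (r • w) ?_
      rw [map_smul f, ← smul_sub, map_smul_eq_mul, map_smul_eq_mul, mul_add])

theorem infSeminorm_le_add (b : Seminorm ℂ X) (f : W →ₗ[ℂ] X) (p : Seminorm ℂ W) (x : X) (w : W) :
    infSeminorm b f p x ≤ p w + b (x - f w) :=
  ciInf_le ⟨0, by rintro _ ⟨w, rfl⟩; positivity⟩ w

theorem infSeminorm_le (b : Seminorm ℂ X) (f : W →ₗ[ℂ] X) (p : Seminorm ℂ W) :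
    infSeminorm b f p ≤ b := fun x => by
  simpa using infSeminorm_le_add b f p x 0

theorem infSeminorm_apply_map {b : Seminorm ℂ X} {f : W →ₗ[ℂ] X} {p : Seminorm ℂ W}
    (h : p ≤ b.comp f) (w : W) : infSeminorm b f p (f w) = p w := by
  refine le_antisymm (by simpa using infSeminorm_le_add b f p (f w) w) (le_ciInf fun v => ?_)
  calc p w = p (v + (w - v)) := by rw [add_sub_cancel]
    _ ≤ p v + p (w - v) := map_add_le_add p _ _
    _ ≤ p v + b (f w - f v) := by rw [← map_sub f]; gcongr; exact h _

/-- Density of the range of a map with respect to a seminorm; seminorms on a fixed space are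
compared below, so none of them is made the topology of the space. -/
def HasDenseRange (b : Seminorm ℂ X) (f : V → X) : Prop :=
  ∀ x, ∀ ε > 0, ∃ v, b (x - f v) < ε

theorem HasDenseRange.exists_seq {b : Seminorm ℂ X} {f : V → X} (hf : HasDenseRange b f) (x : X) :
    ∃ v : ℕ → V, Tendsto (fun n => b (x - f (v n))) atTop (𝓝 0) := by
  choose v hv using fun n : ℕ => hf x (1 / (n + 1)) (by positivity)
  exact ⟨v, squeeze_zero (fun n => apply_nonneg b _) (fun n => (hv n).le)
    tendsto_one_div_add_atTop_nhds_zero_nat⟩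

theorem tendsto_seminorm_of_le {ι : Type*} {l : Filter ι} {q b : Seminorm ℂ X} (h : q ≤ b) {x : X}
    {a : ι → X} (ha : Tendsto (fun n => b (x - a n)) l (𝓝 0)) :
    Tendsto (fun n => q (a n)) l (𝓝 (q x)) := by
  refine tendsto_iff_norm_sub_tendsto_zero.mpr
    (squeeze_zero (fun n => norm_nonneg _) (fun n => ?_) ha)
  calc ‖q (a n) - q x‖ ≤ q (a n - x) := abs_sub_map_le_sub q _ _
    _ ≤ b (x - a n) := by rw [map_sub_rev]; exact h _

end SeminormExtension

section EnvelopeComparison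

variable {W X : Type*} [NonUnitalRing W] [StarRing W] [Module ℂ W]
  [NonUnitalRing X] [StarRing X] [Module ℂ X]

theorem IsStarAlgebraSeminorm.tendsto_mul {ι : Type*} {l : Filter ι} {b : Seminorm ℂ X}
    (hb : IsStarAlgebraSeminorm b) {x y : X} {a c : ι → X}
    (ha : Tendsto (fun n => b (x - a n)) l (𝓝 0)) (hc : Tendsto (fun n => b (y - c n)) l (𝓝 0)) :
    Tendsto (fun n => b (x * y - a n * c n)) l (𝓝 0) := by
  have hlim : Tendsto (fun n => b x * b (y - c n) + b (x - a n) * b (c n)) l (𝓝 0) := by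
    simpa using (hc.const_mul (b x)).add (ha.mul (tendsto_seminorm_of_le le_rfl hc))
  refine squeeze_zero (fun n => apply_nonneg b _) (fun n => ?_) hlim
  calc b (x * y - a n * c n) = b (x * (y - c n) + (x - a n) * c n) := by
        rw [mul_sub, sub_mul, sub_add_sub_cancel]
    _ ≤ b (x * (y - c n)) + b ((x - a n) * c n) := map_add_le_add b _ _
    _ ≤ b x * b (y - c n) + b (x - a n) * b (c n) :=
      add_le_add (hb.map_mul_le _ _) (hb.map_mul_le _ _)

theorem isCStarSeminorm_infSeminorm {b : Seminorm ℂ X} (hb : IsStarAlgebraSeminorm b)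
    {f : W →⋆ₙₐ[ℂ] X} (hf : HasDenseRange b f) {p : Seminorm ℂ W} (hp : IsCStarSeminorm p)
    (h : p ≤ b.comp (f : W →ₗ[ℂ] X)) : IsCStarSeminorm (infSeminorm b (f : W →ₗ[ℂ] X) p) := by
  set q := infSeminorm b (f : W →ₗ[ℂ] X) p
  have hqb : q ≤ b := infSeminorm_le b (f : W →ₗ[ℂ] X) p
  have hqf (w : W) : q (f w) = p w := infSeminorm_apply_map h w
  constructor
  · intro x y
    obtain ⟨v, hv⟩ := hf.exists_seq x
    obtain ⟨w, hw⟩ := hf.exists_seq y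
    refine le_of_tendsto_of_tendsto' (tendsto_seminorm_of_le hqb (hb.tendsto_mul hv hw))
      ((tendsto_seminorm_of_le hqb hv).mul (tendsto_seminorm_of_le hqb hw)) fun n => ?_
    simpa only [← map_mul, hqf] using hp.map_mul_le (v n) (w n)
  · intro x
    obtain ⟨v, hv⟩ := hf.exists_seq x
    have hv' : Tendsto (fun n => b (star x - star (f (v n)))) atTop (𝓝 0) := by
      simpa only [← star_sub, hb.map_star] using hv
    refine tendsto_nhds_unique (tendsto_seminorm_of_le hqb (hb.tendsto_mul hv' hv))
      (((tendsto_seminorm_of_le hqb hv).pow 2).congr fun n => ?_)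
    rw [← StarHomClass.map_star f, ← map_mul, hqf, hqf, hp.map_star_mul_self]

/-- A function `b` on a *-algebra is locally dominated by `c` on `s` if every element of `s` lies in
a *-subalgebra on which `b` is bounded by a multiple of `c`. -/
def IsLocallyDominatedOn (b c : W → ℝ) (s : Set W) : Prop :=
  ∀ w ∈ s, ∃ T : NonUnitalStarSubalgebra ℂ W, w ∈ T ∧ ∃ C ≥ 0, ∀ x ∈ T, b x ≤ C * c x

theorem IsLocallyDominatedOn.restrict {b c : W → ℝ} {V : NonUnitalStarSubalgebra ℂ W}
    (h : IsLocallyDominatedOn b c V) :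
    IsLocallyDominatedOn (fun z : V => b z) (fun z : V => c z) Set.univ := fun z _ => by
  obtain ⟨T, hz, C, hC, hT⟩ := h z z.2
  exact ⟨T.comap (NonUnitalStarSubalgebraClass.subtype V), hz, C, hC, fun x hx => hT x hx⟩

variable [IsScalarTower ℂ W W] [SMulCommClass ℂ W W] [StarModule ℂ W]
  [IsScalarTower ℂ X X] [SMulCommClass ℂ X X] [StarModule ℂ X]

theorem maxCStarSeminorm_le_of_isLocallyDominatedOn {b c : Seminorm ℂ W}
    (hc : IsStarAlgebraSeminorm c) (h : IsLocallyDominatedOn b c Set.univ) :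
    maxCStarSeminorm b ≤ maxCStarSeminorm c := fun w => by
  refine maxCStarSeminorm_le (apply_nonneg _ _) fun p hp hpb => ?_
  refine le_maxCStarSeminorm hp (fun x => ?_) w
  obtain ⟨T, hx, C, hC, hT⟩ := h x trivial
  exact hp.le_of_le_const_mul hc hC (fun y hy => (hpb y).trans (hT y hy)) hx

theorem maxCStarSeminorm_comp {b : Seminorm ℂ X} (hb : IsStarAlgebraSeminorm b)
    {f : W →⋆ₙₐ[ℂ] X} (hf : HasDenseRange b f) (w : W) :
    maxCStarSeminorm (b.comp (f : W →ₗ[ℂ] X)) w = maxCStarSeminorm b (f w) := by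
  refine le_antisymm (maxCStarSeminorm_le (apply_nonneg _ _) fun p hp hpb => ?_)
    (CStarEnvelope.maxCStarSeminorm_map_le f (fun _ => le_rfl) w)
  calc p w = infSeminorm b (f : W →ₗ[ℂ] X) p (f w) :=
        (infSeminorm_apply_map (f := (f : W →ₗ[ℂ] X)) hpb w).symm
    _ ≤ maxCStarSeminorm b (f w) :=
      le_maxCStarSeminorm (isCStarSeminorm_infSeminorm hb hf hp hpb) (infSeminorm_le _ _ _) _

theorem CStarEnvelope.norm_of_le (b : Seminorm ℂ X) (x : X) : ‖CStarEnvelope.of b x‖ ≤ b x := by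
  rw [CStarEnvelope.of_apply, CStarEnvelope.norm_ofL]
  exact maxCStarSeminorm_le (apply_nonneg _ _) fun p _ hb => hb x

theorem HasDenseRange.denseRange_of {V : Type*} {b : Seminorm ℂ X} {f : V → X}
    (hf : HasDenseRange b f) : DenseRange fun v => CStarEnvelope.of b (f v) := fun z => by
  refine CStarEnvelope.induction_on z isClosed_closure fun x => Metric.mem_closure_iff.mpr ?_
  intro ε hε
  obtain ⟨v, hv⟩ := hf x ε hε
  refine ⟨_, ⟨v, rfl⟩, ?_⟩
  rw [dist_eq_norm, ← CStarEnvelope.of_apply, ← map_sub]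
  exact (CStarEnvelope.norm_of_le b _).trans_lt hv

theorem continuous_nonUnitalStarAlgHom {E F : Type*} [NonUnitalCStarAlgebra E]
    [NonUnitalCStarAlgebra F] (f : E →⋆ₙₐ[ℂ] F) : Continuous f :=
  AddMonoidHomClass.continuous_of_bound f 1 fun a => by
    rw [one_mul]; exact NonUnitalStarAlgHom.norm_apply_le f a

theorem CStarEnvelope.hom_ext_of_span {F : Type*} [NonUnitalCStarAlgebra F] {b : Seminorm ℂ X}
    {G : Set X} (hG : HasDenseRange b ((↑) : Submodule.span ℂ G → X))
    {f g : CStarEnvelope b →⋆ₙₐ[ℂ] F}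
    (h : ∀ x ∈ G, f (CStarEnvelope.of b x) = g (CStarEnvelope.of b x)) (z : CStarEnvelope b) :
    f z = g z := by
  refine hG.denseRange_of.induction_on z (isClosed_eq (continuous_nonUnitalStarAlgHom f)
    (continuous_nonUnitalStarAlgHom g)) fun w => ?_
  exact LinearMap.eqOn_span
    (f := ((f.comp (CStarEnvelope.of b) : X →⋆ₙₐ[ℂ] F) : X →ₗ[ℂ] F))
    (g := ((g.comp (CStarEnvelope.of b) : X →⋆ₙₐ[ℂ] F) : X →ₗ[ℂ] F)) h w.2

end EnvelopeComparison

section ExtendIsometry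

variable {W E F : Type*} [NonUnitalRing W] [StarRing W] [Module ℂ W]
  [NonUnitalCStarAlgebra E] [NonUnitalCStarAlgebra F]

/-- The isomorphism between the targets of two *-homomorphisms with dense ranges that induce the
same seminorm on their common domain. -/
def starAlgEquivOfDense (f : W →⋆ₙₐ[ℂ] E) (g : W →⋆ₙₐ[ℂ] F) (hf : DenseRange f)
    (hg : DenseRange g) (h : ∀ w, ‖g w‖ = ‖f w‖) : E ≃⋆ₐ[ℂ] F :=
  let e : E ≃L[ℂ] F := LinearEquiv.extend (LinearEquiv.refl ℂ W) (f : W →ₗ[ℂ] E) (g : W →ₗ[ℂ] F)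
    hf ⟨1, fun w => by rw [one_mul]; exact (h w).le⟩ hg
    ⟨1, fun w => by rw [one_mul]; exact (h w).ge⟩
  have he : ∀ w, e (f w) = g w := fun w => LinearEquiv.extend_eq (LinearEquiv.refl ℂ W)
    (f : W →ₗ[ℂ] E) (g : W →ₗ[ℂ] F) _ _ _ _ w
  { e with
    map_mul' := fun x y => by
      change e (x * y) = e x * e y
      refine hf.induction_on₂ (isClosed_eq (by fun_prop) (by fun_prop)) (fun v w => ?_) x y
      rw [← map_mul, he, he, he, map_mul]
    map_star' := fun x => by
      change e (star x) = star (e x)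
      refine hf.induction_on x (isClosed_eq (by fun_prop) (by fun_prop)) fun w => ?_
      rw [← map_star f, he, he, map_star g]
    map_smul' := fun r x => map_smul e r x }

theorem starAlgEquivOfDense_apply (f : W →⋆ₙₐ[ℂ] E) (g : W →⋆ₙₐ[ℂ] F) (hf : DenseRange f)
    (hg : DenseRange g) (h : ∀ w, ‖g w‖ = ‖f w‖) (w : W) :
    starAlgEquivOfDense f g hf hg h (f w) = g w :=
  LinearEquiv.extend_eq (LinearEquiv.refl ℂ W) (f : W →ₗ[ℂ] E) (g : W →ₗ[ℂ] F) _ _ _ _ w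

end ExtendIsometry

section EnvelopeEquiv

variable {X Y : Type*}
  [NonUnitalRing X] [StarRing X] [Module ℂ X] [IsScalarTower ℂ X X] [SMulCommClass ℂ X X]
  [StarModule ℂ X]
  [NonUnitalRing Y] [StarRing Y] [Module ℂ Y] [IsScalarTower ℂ Y Y] [SMulCommClass ℂ Y Y]
  [StarModule ℂ Y]
  {b : Seminorm ℂ X} {c : Seminorm ℂ Y} {V : NonUnitalStarSubalgebra ℂ (X × Y)}

theorem norm_of_snd_eq_norm_of_fst (hb : IsStarAlgebraSeminorm b) (hc : IsStarAlgebraSeminorm c)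
    (hfst : HasDenseRange b fun z : V => z.1.1) (hsnd : HasDenseRange c fun z : V => z.1.2)
    (hbc : IsLocallyDominatedOn (fun z : X × Y => b z.1) (fun z => c z.2) V)
    (hcb : IsLocallyDominatedOn (fun z : X × Y => c z.2) (fun z => b z.1) V) (z : V) :
    ‖CStarEnvelope.of c z.1.2‖ = ‖CStarEnvelope.of b z.1.1‖ := by
  let f : V →⋆ₙₐ[ℂ] X :=
    (NonUnitalStarAlgHom.fst ℂ X Y).comp (NonUnitalStarSubalgebraClass.subtype V)
  let g : V →⋆ₙₐ[ℂ] Y :=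
    (NonUnitalStarAlgHom.snd ℂ X Y).comp (NonUnitalStarSubalgebraClass.subtype V)
  change ‖CStarEnvelope.ofL _ (g z)‖ = ‖CStarEnvelope.ofL _ (f z)‖
  rw [CStarEnvelope.norm_ofL, CStarEnvelope.norm_ofL, ← maxCStarSeminorm_comp hb hfst,
    ← maxCStarSeminorm_comp hc hsnd]
  exact le_antisymm (maxCStarSeminorm_le_of_isLocallyDominatedOn (hb.comp f) hcb.restrict z)
    (maxCStarSeminorm_le_of_isLocallyDominatedOn (hc.comp g) hbc.restrict z)

variable (hb : IsStarAlgebraSeminorm b) (hc : IsStarAlgebraSeminorm c)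
  (hfst : HasDenseRange b fun z : V => z.1.1) (hsnd : HasDenseRange c fun z : V => z.1.2)
  (hbc : IsLocallyDominatedOn (fun z : X × Y => b z.1) (fun z => c z.2) V)
  (hcb : IsLocallyDominatedOn (fun z : X × Y => c z.2) (fun z => b z.1) V)

/-- The isomorphism between the enveloping C*-algebras of `X` and `Y` which relates `x` to `y` for
`(x, y) ∈ V`. -/
def envelopeEquiv : CStarEnvelope b ≃⋆ₐ[ℂ] CStarEnvelope c :=
  starAlgEquivOfDense
    ((CStarEnvelope.of b).comp
      ((NonUnitalStarAlgHom.fst ℂ X Y).comp (NonUnitalStarSubalgebraClass.subtype V)))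
    ((CStarEnvelope.of c).comp
      ((NonUnitalStarAlgHom.snd ℂ X Y).comp (NonUnitalStarSubalgebraClass.subtype V)))
    hfst.denseRange_of hsnd.denseRange_of (norm_of_snd_eq_norm_of_fst hb hc hfst hsnd hbc hcb)

theorem envelopeEquiv_of {x : X} {y : Y} (hxy : (x, y) ∈ V) :
    envelopeEquiv hb hc hfst hsnd hbc hcb (CStarEnvelope.of b x) = CStarEnvelope.of c y :=
  starAlgEquivOfDense_apply
    ((CStarEnvelope.of b).comp
      ((NonUnitalStarAlgHom.fst ℂ X Y).comp (NonUnitalStarSubalgebraClass.subtype V)))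
    ((CStarEnvelope.of c).comp
      ((NonUnitalStarAlgHom.snd ℂ X Y).comp (NonUnitalStarSubalgebraClass.subtype V)))
    _ _ _ ⟨(x, y), hxy⟩

end EnvelopeEquiv

/-! ### Trigonometric polynomials and spectral subspaces -/

section SpanClosure

variable {R E F : Type*} [Semiring R] [TopologicalSpace E] [AddCommMonoid E] [Module R E]
  [ContinuousAdd E] [ContinuousConstSMul R E] [TopologicalSpace F] [AddCommMonoid F] [Module R F]
  [ContinuousAdd F] [ContinuousConstSMul R F]

theorem map_mem_topologicalClosure_of_span (L : E →L[R] F) {G : Set E} {N : Submodule R F}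
    (h : ∀ x ∈ G, L x ∈ N.topologicalClosure) {x : E}
    (hx : x ∈ (Submodule.span R G).topologicalClosure) : L x ∈ N.topologicalClosure :=
  Submodule.topologicalClosure_minimal (Submodule.span R G)
    (t := N.topologicalClosure.comap (L : E →ₗ[R] F)) (Submodule.span_le.mpr h)
    (N.isClosed_topologicalClosure.preimage L.continuous) hx

end SpanClosure

section SmulConst

variable {X 𝕜 E : Type*} [TopologicalSpace X] [CompactSpace X] [T2Space X] [RCLike 𝕜]
  [NormedAddCommGroup E] [NormedSpace 𝕜 E]

theorem mem_topologicalClosure_span_smul_const (f : C(X, E)) :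
    f ∈ (Submodule.span 𝕜 {h : C(X, E) | ∃ g a,
      h = (ContinuousLinearMap.toSpanSingleton 𝕜 a).compLeftContinuous 𝕜 X g}
      ).topologicalClosure := by
  let : NormedSpace ℝ E := NormedSpace.restrictScalars ℝ 𝕜 E
  refine Metric.mem_closure_iff.mpr fun ε hε => ?_
  obtain ⟨s, hs⟩ := isCompact_univ.elim_finite_subcover (fun x => f ⁻¹' Metric.ball (f x) ε)
    (fun x => Metric.isOpen_ball.preimage f.continuous)
    fun x _ => Set.mem_iUnion.mpr ⟨x, Metric.mem_ball_self hε⟩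
  obtain ⟨ρ, hρ⟩ := PartitionOfUnity.exists_isSubordinate isClosed_univ
    (fun x : s => f ⁻¹' Metric.ball (f x) ε) (fun x => Metric.isOpen_ball.preimage f.continuous)
    (by rwa [Set.iUnion_subtype])
  let g (x : s) : C(X, 𝕜) := RCLike.ofRealCLM.compLeftContinuous ℝ X (ρ x)
  refine ⟨∑ x : s, (ContinuousLinearMap.toSpanSingleton 𝕜 (f x)).compLeftContinuous 𝕜 X (g x),
    Submodule.sum_mem _ fun x _ => Submodule.subset_span ⟨g x, f x, rfl⟩, ?_⟩
  refine (ContinuousMap.dist_lt_iff hε).mpr fun t => ?_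
  have hsum : ∑ᶠ x, ρ x t • f x ∈ Metric.ball (f t) ε :=
    ρ.finsum_smul_mem_convex (g := fun x _ => f x) (Set.mem_univ t)
      (fun x hx => Metric.mem_ball_comm.mp (hρ x (subset_closure hx))) (convex_ball _ _)
  rw [dist_comm, ContinuousMap.sum_apply]
  rw [finsum_eq_sum_of_fintype] at hsum
  refine (congrArg (dist · (f t)) (Finset.sum_congr rfl fun x _ => ?_)).trans_lt hsum
  exact (RCLike.real_smul_eq_coe_smul (K := 𝕜) (ρ x t) (f x)).symm

end SmulConst

section Trigonometric

variable {E : Type*} [NormedAddCommGroup E] [NormedSpace ℂ E]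

@[fun_prop]
theorem continuous_circle_coe_zpow (m : ℤ) : Continuous fun t : Circle => ((t ^ m : Circle) : ℂ) :=
  continuous_subtype_val.comp (continuous_zpow m)

/-- The function `t ↦ tᵐ a` on the circle, as a function of its coefficient `a`. -/
def trigMonomial (m : ℤ) : E →L[ℂ] C(Circle, E) :=
  LinearMap.mkContinuous
    { toFun := fun a => ⟨fun t => ((t ^ m : Circle) : ℂ) • a, by fun_prop⟩
      map_add' := fun a b => by ext t; exact smul_add _ a b
      map_smul' := fun r a => by ext t; exact smul_comm _ r a } 1
    fun a => (ContinuousMap.norm_le _ (by positivity)).mpr fun t => by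
      rw [one_mul]
      exact (norm_smul_le _ a).trans_eq (by rw [Circle.norm_coe, one_mul])

theorem trigMonomial_apply (m : ℤ) (a : E) (t : Circle) :
    trigMonomial m a t = ((t ^ m : Circle) : ℂ) • a := rfl

theorem norm_trigMonomial_le (m : ℤ) (a : E) : ‖trigMonomial m a‖ ≤ ‖a‖ :=
  (ContinuousMap.norm_le _ (norm_nonneg a)).mpr fun t => by
    rw [trigMonomial_apply, norm_smul, Circle.norm_coe, one_mul]

theorem exists_circle_zpow_ne_one {n : ℤ} (hn : n ≠ 0) : ∃ s : Circle, s ^ n ≠ 1 := by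
  refine ⟨Circle.exp (Real.pi / n), fun h => ?_⟩
  rw [← Circle.exp_zsmul, zsmul_eq_mul, mul_div_cancel₀ _ (by exact_mod_cast hn)] at h
  have := congrArg ((↑) : Circle → ℂ) h
  norm_num [Circle.coe_exp] at this

theorem integral_zpow_smul [CompleteSpace E] (n : ℤ) (a : E) :
    ∫ t : Circle, ((t ^ n : Circle) : ℂ) • a ∂circleHaar = if n = 0 then a else 0 := by
  split_ifs with hn
  · simp [hn]
  obtain ⟨s, hs⟩ := exists_circle_zpow_ne_one hn
  set I := ∫ t : Circle, ((t ^ n : Circle) : ℂ) • a ∂circleHaar with hI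
  have hsI : ((s ^ n : Circle) : ℂ) • I = (1 : ℂ) • I := by
    rw [one_smul, hI, ← integral_smul]
    conv_rhs => rw [← integral_mul_left_eq_self _ s]
    simp only [mul_zpow, Circle.coe_mul, mul_smul]
  rw [← sub_eq_zero, ← sub_smul] at hsI
  exact (smul_eq_zero.mp hsI).resolve_left fun h => hs (Circle.ext (sub_eq_zero.mp h))

theorem mem_topologicalClosure_span_trigMonomial_one (f : C(Circle, ℂ)) :
    f ∈ (Submodule.span ℂ
      (Set.range fun m : ℤ => trigMonomial m (1 : ℂ))).topologicalClosure := by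
  have : Fact (0 < (1 : ℝ)) := ⟨one_pos⟩
  let e : AddCircle (1 : ℝ) ≃ₜ Circle := AddCircle.homeomorphCircle one_ne_zero
  let L : C(AddCircle (1 : ℝ), ℂ) →L[ℂ] C(Circle, ℂ) :=
    { toFun := fun g => g.comp e.symm
      map_add' := fun _ _ => rfl
      map_smul' := fun _ _ => rfl
      cont := ContinuousMap.continuous_precomp _ }
  have hL (n : ℤ) : L (fourier n) = trigMonomial n 1 := by
    ext t
    obtain ⟨x, rfl⟩ := e.surjective t
    change fourier n (e.symm (e x)) = ((e x ^ n : Circle) : ℂ) • (1 : ℂ)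
    rw [e.symm_apply_apply, fourier_apply, AddCircle.toCircle_zsmul, smul_eq_mul, mul_one,
      AddCircle.homeomorphCircle_apply]
  have hf : L (f.comp e) = f := by
    ext t
    exact congrArg f (e.apply_symm_apply t)
  rw [← hf]
  refine map_mem_topologicalClosure_of_span L (G := Set.range (fourier (T := 1))) ?_
    (by rw [span_fourier_closure_eq_top]; trivial)
  rintro _ ⟨n, rfl⟩
  exact Submodule.le_topologicalClosure _ (Submodule.subset_span ⟨n, (hL n).symm⟩)

theorem mem_topologicalClosure_span_trigMonomial (f : C(Circle, E)) :
    f ∈ (Submodule.span ℂ {g : C(Circle, E) | ∃ m a, g = trigMonomial m a}).topologicalClosure := by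
  refine map_mem_topologicalClosure_of_span (.id ℂ C(Circle, E)) ?_
    (mem_topologicalClosure_span_smul_const (𝕜 := ℂ) f)
  rintro _ ⟨g, a, rfl⟩
  refine map_mem_topologicalClosure_of_span
    ((ContinuousLinearMap.toSpanSingleton ℂ a).compLeftContinuous ℂ Circle) ?_
    (mem_topologicalClosure_span_trigMonomial_one g)
  rintro _ ⟨m, rfl⟩
  refine Submodule.le_topologicalClosure _ (Submodule.subset_span ⟨m, a, ?_⟩)
  ext t
  change (((t ^ m : Circle) : ℂ) • (1 : ℂ)) • a = ((t ^ m : Circle) : ℂ) • a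
  rw [smul_eq_mul, mul_one]

end Trigonometric

namespace CircleAction

variable {A : Type*} [CStarAlgebra A] (α : CircleAction A)

/-- The averaging operator `q ↦ ∫ α_s⁻¹(q(s)) ds`. -/
def average : C(Circle, A) →L[ℂ] A :=
  LinearMap.mkContinuous
    { toFun := fun q => ∫ s, α s⁻¹ (q s) ∂circleHaar
      map_add' := fun p q => by
        simp only [ContinuousMap.add_apply, map_add]
        exact integral_add (integrable_circle (by fun_prop)) (integrable_circle (by fun_prop))
      map_smul' := fun r q => by
        simp only [ContinuousMap.smul_apply, map_smul]
        exact integral_smul r _ } 1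
    fun q => by
      refine (norm_integral_le_of_norm_le_const (C := ‖q‖) (.of_forall fun s => ?_)).trans (by simp)
      rw [StarAlgEquiv.norm_map]
      exact q.norm_coe_le_norm s

theorem average_apply (q : C(Circle, A)) : α.average q = ∫ s, α s⁻¹ (q s) ∂circleHaar := rfl

theorem norm_average_le (q : C(Circle, A)) : ‖α.average q‖ ≤ ‖q‖ :=
  one_mul ‖q‖ ▸ ContinuousLinearMap.le_of_opNorm_le _
    (LinearMap.mkContinuous_norm_le _ zero_le_one _) q

theorem average_orbit (a : A) : α.average ⟨fun s => α s a, α.continuous_apply a⟩ = a := by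
  simp only [average_apply, ContinuousMap.coe_mk, ← α.mul_apply, inv_mul_cancel, α.one_apply]
  simp

/-- The spectral subspace `{a | α_ζ(a) = ζⁿ a for all ζ}`. -/
def spectralSubspace (n : ℤ) : Submodule ℂ A where
  carrier := {a | ∀ ζ : Circle, α ζ a = ((ζ ^ n : Circle) : ℂ) • a}
  zero_mem' ζ := by rw [map_zero, smul_zero]
  add_mem' ha hb ζ := by rw [map_add, ha, hb, smul_add]
  smul_mem' r a ha ζ := by rw [map_smul, ha, smul_comm]

variable {α}

theorem mem_fixedPoints_iff {a : A} : a ∈ α.fixedPoints ↔ a ∈ α.spectralSubspace 0 := by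
  change (∀ ζ, α ζ a = a) ↔ ∀ ζ : Circle, α ζ a = ((ζ ^ (0 : ℤ) : Circle) : ℂ) • a
  simp only [zpow_zero, Circle.coe_one, one_smul]

theorem mul_mem_spectralSubspace {m n : ℤ} {a b : A} (ha : a ∈ α.spectralSubspace m)
    (hb : b ∈ α.spectralSubspace n) : a * b ∈ α.spectralSubspace (m + n) := fun ζ => by
  rw [map_mul, ha, hb, smul_mul_smul_comm, ← Circle.coe_mul, zpow_add]

theorem star_mem_spectralSubspace {n : ℤ} {a : A} (ha : a ∈ α.spectralSubspace n) :
    star a ∈ α.spectralSubspace (-n) := fun ζ => by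
  rw [map_star, ha, star_smul, zpow_neg, Circle.coe_inv_eq_conj]
  rfl

variable (α)

theorem average_trigMonomial_mem (n : ℤ) (b : A) :
    α.average (trigMonomial n b) ∈ α.spectralSubspace n := fun ζ => by
  rw [average_apply, α.act_integral ζ (integrable_circle (by fun_prop)), ← integral_smul,
    ← integral_mul_left_eq_self _ ζ]
  congr 1 with s
  rw [← α.mul_apply, trigMonomial_apply, trigMonomial_apply, map_smul, map_smul, smul_smul,
    ← Circle.coe_mul, ← mul_zpow, mul_inv_rev, mul_inv_cancel_comm_assoc]

theorem mem_topologicalClosure_span_spectralSubspace (a : A) :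
    a ∈ (Submodule.span ℂ {b | ∃ n, b ∈ α.spectralSubspace n}).topologicalClosure := by
  rw [← α.average_orbit a]
  refine map_mem_topologicalClosure_of_span α.average ?_
    (mem_topologicalClosure_span_trigMonomial _)
  rintro _ ⟨n, b, rfl⟩
  exact Submodule.le_topologicalClosure _
    (Submodule.subset_span ⟨n, α.average_trigMonomial_mem n b⟩)

/-- The projection `a ↦ ∫ sⁿ α_s⁻¹(a) ds` onto the `n`-th spectral subspace. -/
def spectralProj (n : ℤ) : A →L[ℂ] A := α.average ∘L trigMonomial n

theorem norm_spectralProj_le (n : ℤ) (a : A) : ‖α.spectralProj n a‖ ≤ ‖a‖ :=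
  (α.norm_average_le _).trans (norm_trigMonomial_le n a)

variable {α}

theorem spectralProj_apply_of_mem {m : ℤ} {a : A} (ha : a ∈ α.spectralSubspace m) (n : ℤ) :
    α.spectralProj n a = if m = n then a else 0 := by
  have h (s : Circle) : α s⁻¹ (trigMonomial n a s) = ((s ^ (n - m) : Circle) : ℂ) • a := by
    rw [trigMonomial_apply, map_smul, ha, smul_smul, ← Circle.coe_mul, inv_zpow', zpow_sub,
      zpow_neg]
  change α.average (trigMonomial n a) = _
  simp only [average_apply, h, integral_zpow_smul, sub_eq_zero, eq_comm]

end CircleAction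

/-! ### Matrix units in the compact operators -/

section MatrixUnits

open InnerProductSpace

section Approximation

variable {𝕜 E F : Type*} [RCLike 𝕜] [NormedAddCommGroup E] [NormedSpace 𝕜 E]
  [NormedAddCommGroup F] [NormedSpace 𝕜 F]

theorem tendsto_comp_of_isCompactOperator {ι : Type*} {l : Filter ι} {P : ι → F →L[𝕜] F}
    (hP : ∀ i, ‖P i‖ ≤ 1) (hPx : ∀ x, Tendsto (fun i => P i x) l (𝓝 x)) {T : E →L[𝕜] F}
    (hT : IsCompactOperator T) : Tendsto (fun i => P i ∘L T) l (𝓝 T) := by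
  have hball := (hT.isCompact_closure_image_closedBall (f := (T : E →ₗ[𝕜] F)) 1).totallyBounded
  refine Metric.tendsto_nhds.mpr fun ε hε => ?_
  obtain ⟨t, htf, ht⟩ := Metric.totallyBounded_iff.mp (hball.subset subset_closure) (ε / 4)
    (by positivity)
  have hclose : ∀ᶠ i in l, ∀ y ∈ t, dist (P i y) y < ε / 4 :=
    (eventually_all_finite htf).mpr fun y _ => Metric.tendsto_nhds.mp (hPx y) _ (by positivity)
  filter_upwards [hclose] with i hi
  rw [dist_eq_norm]
  refine (ContinuousLinearMap.opNorm_le_of_unit_norm (C := 3 * (ε / 4)) (by positivity)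
    fun x hx => ?_).trans_lt (by linarith)
  obtain ⟨y, hy, hxy⟩ := Set.mem_iUnion₂.mp (ht ⟨x, by simp [hx], rfl⟩)
  have hPxy : dist (P i (T x)) (P i y) ≤ dist (T x) y := by
    simpa only [dist_eq_norm, map_sub, one_mul] using (P i).le_of_opNorm_le (hP i) (T x - y)
  calc ‖(P i ∘L T - T) x‖ = dist (P i (T x)) (T x) := (dist_eq_norm _ _).symm
    _ ≤ dist (P i (T x)) (P i y) + dist (P i y) y + dist y (T x) := dist_triangle4 _ _ _ _
    _ ≤ ε / 4 + ε / 4 + ε / 4 := by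
      gcongr
      · exact hPxy.trans hxy.le
      · exact (hi y hy).le
      · exact (Metric.mem_ball_comm.mp hxy).le
    _ = 3 * (ε / 4) := by ring

end Approximation

variable {H : Type*} [NormedAddCommGroup H] [InnerProductSpace ℂ H]

theorem isCompactOperator_rankOne (x y : H) : IsCompactOperator (rankOne ℂ x y : H →L[ℂ] H) :=
  (isCompactOperator_of_locallyCompactSpace_rng
    (ContinuousLinearMap.toSpanSingleton ℂ x)).comp_clm (innerSL ℂ y)

variable {ι : Type*} (e : HilbertBasis ι ℂ H)

/-- The orthogonal projection onto the span of the basis vectors indexed by `S`. -/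
def basisProj (S : Finset ι) : H →L[ℂ] H := ∑ i ∈ S, rankOne ℂ (e i) (e i)

theorem tendsto_basisProj (x : H) : Tendsto (fun S => basisProj e S x) atTop (𝓝 x) := by
  refine Tendsto.congr (fun S => ?_) (e.hasSum_repr x)
  simp [basisProj, HilbertBasis.repr_apply_apply]

theorem inner_basis [DecidableEq ι] (i j : ι) :
    inner ℂ (e i) (e j) = if i = j then (1 : ℂ) else 0 :=
  orthonormal_iff_ite.mp e.orthonormal i j

theorem rankOne_basis_mul_rankOne_basis [DecidableEq ι] (i j k l : ι) :
    rankOne ℂ (e i) (e j) * rankOne ℂ (e k) (e l) =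
      if j = k then (rankOne ℂ (e i) (e l) : H →L[ℂ] H) else 0 := by
  rw [ContinuousLinearMap.mul_def, rankOne_comp_rankOne, inner_basis, ite_smul, one_smul, zero_smul]

variable [CompleteSpace H]

theorem isStarProjection_basisProj (S : Finset ι) : IsStarProjection (basisProj e S) where
  isIdempotentElem := by
    classical
    simp only [IsIdempotentElem, basisProj, Finset.sum_mul_sum, rankOne_basis_mul_rankOne_basis,
      Finset.sum_ite_eq, Finset.sum_ite_mem, Finset.inter_self]
  isSelfAdjoint := by
    simp only [IsSelfAdjoint, basisProj, star_sum, ContinuousLinearMap.star_eq_adjoint,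
      adjoint_rankOne]

theorem tendsto_basisProj_mul {T : H →L[ℂ] H} (hT : IsCompactOperator T) :
    Tendsto (fun S => basisProj e S * T) atTop (𝓝 T) :=
  tendsto_comp_of_isCompactOperator (fun S => (isStarProjection_basisProj e S).norm_le)
    (tendsto_basisProj e) hT

theorem tendsto_basisProj_mul_mul_basisProj {T : H →L[ℂ] H} (hT : IsCompactOperator T) :
    Tendsto (fun S => basisProj e S * T * basisProj e S) atTop (𝓝 T) := by
  have hright : Tendsto (fun S => T * basisProj e S) atTop (𝓝 T) := by
    simpa [(isStarProjection_basisProj e _).isSelfAdjoint.star_eq] using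
      (tendsto_basisProj_mul e (isCompactOperator_star hT)).star
  have hdiff : Tendsto (fun S => basisProj e S * (T * basisProj e S - T)) atTop (𝓝 0) := by
    refine squeeze_zero_norm (fun S => ?_) (tendsto_iff_norm_sub_tendsto_zero.mp hright)
    refine (norm_mul_le _ _).trans (mul_le_of_le_one_left (norm_nonneg _) ?_)
    exact (isStarProjection_basisProj e S).norm_le
  simpa [mul_sub, mul_assoc] using hdiff.add (tendsto_basisProj_mul e hT)

/-- The matrix units of the compact operators with respect to an orthonormal basis. -/
def matrixUnit (i j : ι) : compactOperators H :=
  ⟨rankOne ℂ (e i) (e j), isCompactOperator_rankOne _ _⟩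

theorem norm_matrixUnit (i j : ι) : ‖matrixUnit e i j‖ = 1 := by
  change ‖rankOne ℂ (e i) (e j)‖ = 1
  rw [norm_rankOne, e.orthonormal.norm_eq_one, e.orthonormal.norm_eq_one, one_mul]

theorem star_matrixUnit (i j : ι) : star (matrixUnit e i j) = matrixUnit e j i :=
  Subtype.ext (adjoint_rankOne (e i) (e j))

theorem matrixUnit_mul_matrixUnit [DecidableEq ι] (i j k l : ι) :
    matrixUnit e i j * matrixUnit e k l = if j = k then matrixUnit e i l else 0 := by
  refine Subtype.ext ((rankOne_basis_mul_rankOne_basis e i j k l).trans ?_)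
  split_ifs <;> rfl

/-- The matrix entries of a compact operator. -/
def matrixEntry (i j : ι) : compactOperators H →ₗ[ℂ] ℂ :=
  ((innerSL ℂ (e i)).toLinearMap ∘ₗ (ContinuousLinearMap.apply ℂ H (e j)).toLinearMap) ∘ₗ
    (NonUnitalStarSubalgebraClass.subtype (compactOperators H) : _ →ₗ[ℂ] (H →L[ℂ] H))

theorem matrixEntry_apply (i j : ι) (T : compactOperators H) :
    matrixEntry e i j T = inner ℂ (e i) ((T : H →L[ℂ] H) (e j)) := rfl

theorem norm_matrixEntry_le (i j : ι) (T : compactOperators H) : ‖matrixEntry e i j T‖ ≤ ‖T‖ := by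
  calc ‖matrixEntry e i j T‖ ≤ ‖e i‖ * ‖(T : H →L[ℂ] H) (e j)‖ := norm_inner_le_norm _ _
    _ ≤ ‖e i‖ * (‖T‖ * ‖e j‖) := by gcongr; exact (T : H →L[ℂ] H).le_opNorm (e j)
    _ = ‖T‖ := by simp only [e.orthonormal.norm_eq_one, one_mul, mul_one]

theorem matrixEntry_matrixUnit [DecidableEq ι] (i j k l : ι) :
    matrixEntry e i j (matrixUnit e k l) = if i = k ∧ l = j then 1 else 0 := by
  change inner ℂ (e i) (inner ℂ (e l) (e j) • e k) = _
  rw [inner_smul_right, inner_basis, inner_basis]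
  split_ifs <;> simp_all

theorem coe_sum_matrixEntry_smul_matrixUnit (S : Finset ι) (T : compactOperators H) :
    ((∑ i ∈ S, ∑ j ∈ S, matrixEntry e i j T • matrixUnit e i j : compactOperators H) :
      H →L[ℂ] H) = basisProj e S * T * basisProj e S := by
  rw [basisProj, Finset.sum_mul, Finset.sum_mul_sum]
  push_cast
  refine Finset.sum_congr rfl fun i _ => Finset.sum_congr rfl fun j _ => ?_
  ext x
  simp [matrixEntry_apply, matrixUnit, smul_smul, mul_comm]

theorem mem_topologicalClosure_span_matrixUnit (T : compactOperators H) :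
    T ∈ (Submodule.span ℂ {K | ∃ i j, K = matrixUnit e i j}).topologicalClosure := by
  refine mem_closure_of_tendsto (b := atTop)
    (f := fun S => ∑ i ∈ S, ∑ j ∈ S, matrixEntry e i j T • matrixUnit e i j) ?_
    (.of_forall fun S => ?_)
  · rw [tendsto_subtype_rng]
    simpa only [coe_sum_matrixEntry_smul_matrixUnit] using
      tendsto_basisProj_mul_mul_basisProj e T.2
  · exact Submodule.sum_mem _ fun i _ => Submodule.sum_mem _ fun j _ =>
      Submodule.smul_mem _ _ (Submodule.subset_span ⟨i, j, rfl⟩)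

end MatrixUnits

section FourierBasis

/-- The character `tᵐ` as an element of `L²(𝕋)`. -/
def circleChar (m : ℤ) : L2Circle := ContinuousMap.toLp 2 circleHaar ℂ (trigMonomial m 1)

theorem orthonormal_circleChar : Orthonormal ℂ circleChar := by
  rw [orthonormal_iff_ite]
  intro i j
  have h (t : Circle) : trigMonomial j (1 : ℂ) t * (starRingEnd ℂ) (trigMonomial i (1 : ℂ) t) =
      ((t ^ (j - i) : Circle) : ℂ) • (1 : ℂ) := by
    simp only [trigMonomial_apply, smul_eq_mul, mul_one, ← Circle.coe_inv_eq_conj,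
      ← Circle.coe_mul, zpow_sub]
  simp only [circleChar, ContinuousMap.inner_toLp, h, integral_zpow_smul, sub_eq_zero, eq_comm]

theorem top_le_topologicalClosure_span_circleChar :
    ⊤ ≤ (Submodule.span ℂ (Set.range circleChar)).topologicalClosure := by
  have h := (ContinuousMap.toLp_denseRange ℂ circleHaar ℂ
    (p := 2) (by norm_num)).topologicalClosure_map_submodule
    (eq_top_iff.mpr fun f _ => mem_topologicalClosure_span_trigMonomial_one f)
  rw [Submodule.map_span, ← Set.range_comp] at h
  exact h.ge

/-- The Hilbert basis of `L²(𝕋)` that consists of the characters. -/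
def circleBasis : HilbertBasis ℤ ℂ L2Circle :=
  HilbertBasis.mk orthonormal_circleChar top_le_topologicalClosure_span_circleChar

end FourierBasis

/-! ### The projective tensor norm and the `L¹`-norm -/

section ProjectiveNorm

variable {A B : Type*} [NonUnitalCStarAlgebra A] [NonUnitalCStarAlgebra B]

theorem projectiveNorm_sum_tmul_le (l : List (A × B)) :
    projectiveNorm A B (l.map fun x => x.1 ⊗ₜ[ℂ] x.2).sum ≤
      (l.map fun x => ‖x.1‖ * ‖x.2‖).sum := by
  refine csInf_le ⟨0, ?_⟩ ⟨l, rfl, rfl⟩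
  rintro _ ⟨m, -, rfl⟩
  refine List.sum_nonneg fun r hr => ?_
  obtain ⟨x, -, rfl⟩ := List.mem_map.mp hr
  positivity

theorem projectiveNorm_tmul_le (a : A) (b : B) : projectiveNorm A B (a ⊗ₜ b) ≤ ‖a‖ * ‖b‖ := by
  simpa using projectiveNorm_sum_tmul_le [(a, b)]

theorem projectiveNorm_nonneg (t : A ⊗[ℂ] B) : 0 ≤ projectiveNorm A B t := by
  refine Real.sInf_nonneg ?_
  rintro _ ⟨l, -, rfl⟩
  refine List.sum_nonneg fun r hr => ?_
  obtain ⟨x, -, rfl⟩ := List.mem_map.mp hr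
  positivity

theorem projectiveNorm_zero : projectiveNorm A B 0 = 0 :=
  le_antisymm (by simpa using projectiveNorm_sum_tmul_le ([] : List (A × B)))
    (projectiveNorm_nonneg 0)

theorem exists_sum_tmul_eq (t : A ⊗[ℂ] B) :
    ∃ l : List (A × B), (l.map fun x => x.1 ⊗ₜ[ℂ] x.2).sum = t := by
  induction t using TensorProduct.induction_on with
  | zero => exact ⟨[], rfl⟩
  | tmul a b => exact ⟨[(a, b)], by simp⟩
  | add s t hs ht =>
    obtain ⟨l, rfl⟩ := hs
    obtain ⟨m, rfl⟩ := ht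
    exact ⟨l ++ m, by simp⟩

theorem le_projectiveNorm {t : A ⊗[ℂ] B} {r : ℝ}
    (h : ∀ l : List (A × B), (l.map fun x => x.1 ⊗ₜ[ℂ] x.2).sum = t →
      r ≤ (l.map fun x => ‖x.1‖ * ‖x.2‖).sum) : r ≤ projectiveNorm A B t := by
  obtain ⟨l, hl⟩ := exists_sum_tmul_eq t
  refine le_csInf ⟨_, l, hl, rfl⟩ ?_
  rintro _ ⟨m, hm, rfl⟩
  exact h m hm

theorem projectiveNorm_add_le (s t : A ⊗[ℂ] B) :
    projectiveNorm A B (s + t) ≤ projectiveNorm A B s + projectiveNorm A B t := by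
  rw [← sub_le_iff_le_add]
  refine le_projectiveNorm fun l hl => ?_
  rw [sub_le_comm]
  refine le_projectiveNorm fun m hm => ?_
  rw [sub_le_iff_le_add', ← hl, ← hm]
  simpa using projectiveNorm_sum_tmul_le (l ++ m)

theorem le_mul_projectiveNorm {p : A ⊗[ℂ] B → ℝ} {C : ℝ} (hC : 0 ≤ C) (h_zero : p 0 ≤ 0)
    (h_add : ∀ s t, p (s + t) ≤ p s + p t) (h_tmul : ∀ a b, p (a ⊗ₜ b) ≤ C * (‖a‖ * ‖b‖))
    (t : A ⊗[ℂ] B) : p t ≤ C * projectiveNorm A B t := by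
  have sum_le (l : List (A × B)) : p (l.map fun x => x.1 ⊗ₜ[ℂ] x.2).sum ≤
      C * (l.map fun x => ‖x.1‖ * ‖x.2‖).sum := by
    induction l with
    | nil => simpa using h_zero
    | cons x l ih =>
      rw [List.map_cons, List.sum_cons, List.map_cons, List.sum_cons, mul_add]
      exact (h_add _ _).trans (add_le_add (h_tmul _ _) ih)
  obtain ⟨l, rfl⟩ := exists_sum_tmul_eq t
  rcases hC.eq_or_lt with rfl | hC
  · simpa using sum_le l
  · rw [← div_le_iff₀' hC]
    refine le_projectiveNorm fun m hm => ?_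
    rw [div_le_iff₀' hC, ← hm]
    exact sum_le m

theorem projectiveNorm_smul_le (r : ℂ) (t : A ⊗[ℂ] B) :
    projectiveNorm A B (r • t) ≤ ‖r‖ * projectiveNorm A B t := by
  refine le_mul_projectiveNorm (p := fun t => projectiveNorm A B (r • t)) (norm_nonneg r)
    (by rw [smul_zero, projectiveNorm_zero])
    (fun s t => by rw [smul_add]; exact projectiveNorm_add_le _ _) (fun a b => ?_) t
  rw [TensorProduct.smul_tmul', ← mul_assoc, ← norm_smul]
  exact projectiveNorm_tmul_le _ _

variable (A B) in
/-- The projective tensor norm as a seminorm. -/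
def projectiveSeminorm : Seminorm ℂ (A ⊗[ℂ] B) :=
  Seminorm.ofSMulLE (projectiveNorm A B) projectiveNorm_zero projectiveNorm_add_le
    projectiveNorm_smul_le

theorem projectiveNorm_star_le (t : A ⊗[ℂ] B) :
    projectiveNorm A B (star t) ≤ projectiveNorm A B t := by
  rw [← one_mul (projectiveNorm A B t)]
  refine le_mul_projectiveNorm (p := fun t => projectiveNorm A B (star t)) zero_le_one
    (by rw [star_zero, projectiveNorm_zero])
    (fun s t => by rw [star_add]; exact projectiveNorm_add_le _ _) (fun a b => ?_) t
  rw [one_mul, TensorProduct.star_tmul, ← norm_star a, ← norm_star b]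
  exact projectiveNorm_tmul_le _ _

theorem projectiveNorm_mul_le (s t : A ⊗[ℂ] B) :
    projectiveNorm A B (s * t) ≤ projectiveNorm A B s * projectiveNorm A B t := by
  have tmul_mul_le (a : A) (b : B) (t : A ⊗[ℂ] B) :
      projectiveNorm A B (a ⊗ₜ b * t) ≤ ‖a‖ * ‖b‖ * projectiveNorm A B t := by
    refine le_mul_projectiveNorm (p := fun t => projectiveNorm A B (a ⊗ₜ b * t)) (by positivity)
      (by rw [mul_zero, projectiveNorm_zero])
      (fun s t => by rw [mul_add]; exact projectiveNorm_add_le _ _) (fun c d => ?_) t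
    calc projectiveNorm A B (a ⊗ₜ b * c ⊗ₜ d) ≤ ‖a * c‖ * ‖b * d‖ := by
          rw [Algebra.TensorProduct.tmul_mul_tmul]
          exact projectiveNorm_tmul_le _ _
      _ ≤ (‖a‖ * ‖c‖) * (‖b‖ * ‖d‖) := by gcongr <;> exact norm_mul_le _ _
      _ = ‖a‖ * ‖b‖ * (‖c‖ * ‖d‖) := by ring
  rw [mul_comm (projectiveNorm A B s)]
  refine le_mul_projectiveNorm (p := fun s => projectiveNorm A B (s * t))
    (projectiveNorm_nonneg t) (by rw [zero_mul, projectiveNorm_zero])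
    (fun r s => by rw [add_mul]; exact projectiveNorm_add_le _ _) (fun a b => ?_) s
  rw [mul_comm (projectiveNorm A B t)]
  exact tmul_mul_le a b t

theorem isStarAlgebraSeminorm_projectiveSeminorm :
    IsStarAlgebraSeminorm (projectiveSeminorm A B) where
  map_mul_le := projectiveNorm_mul_le
  map_star t := le_antisymm (projectiveNorm_star_le t)
    (by simpa using! projectiveNorm_star_le (star t))

/-- The slice map `a ⊗ b ↦ ψ(b) a` of a functional `ψ`. -/
def slice (ψ : B →ₗ[ℂ] ℂ) : A ⊗[ℂ] B →ₗ[ℂ] A :=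
  (TensorProduct.rid ℂ A).toLinearMap ∘ₗ TensorProduct.map LinearMap.id ψ

theorem slice_tmul (ψ : B →ₗ[ℂ] ℂ) (a : A) (b : B) : slice ψ (a ⊗ₜ b) = ψ b • a := rfl

theorem norm_slice_le {ψ : B →ₗ[ℂ] ℂ} (hψ : ∀ b, ‖ψ b‖ ≤ ‖b‖) (t : A ⊗[ℂ] B) :
    ‖slice ψ t‖ ≤ projectiveNorm A B t := by
  rw [← one_mul (projectiveNorm A B t)]
  refine le_mul_projectiveNorm (p := fun t => ‖slice ψ t‖) zero_le_one
    (by rw [map_zero, norm_zero])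
    (fun s t => by rw [map_add]; exact norm_add_le _ _) (fun a b => ?_) t
  rw [slice_tmul, norm_smul, one_mul, mul_comm]
  exact mul_le_mul_of_nonneg_left (hψ b) (norm_nonneg a)

theorem hasDenseRange_span_tmul {G : Set B}
    (hG : ∀ b, b ∈ (Submodule.span ℂ G).topologicalClosure) :
    HasDenseRange (projectiveSeminorm A B)
      ((↑) : Submodule.span ℂ {t : A ⊗[ℂ] B | ∃ a, ∃ g ∈ G, t = a ⊗ₜ g} → A ⊗[ℂ] B) := by
  intro t
  induction t using TensorProduct.induction_on with
  | zero => exact fun ε hε => ⟨0, by simpa using hε⟩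
  | tmul a b =>
    intro ε hε
    obtain ⟨c, hc, hbc⟩ := Metric.mem_closure_iff.mp (hG b) (ε / (‖a‖ + 1)) (by positivity)
    have tmul_mem : a ⊗ₜ c ∈ Submodule.span ℂ {t : A ⊗[ℂ] B | ∃ a, ∃ g ∈ G, t = a ⊗ₜ g} := by
      have := Submodule.mem_map_of_mem (f := TensorProduct.mk ℂ A B a) hc
      rw [Submodule.map_span] at this
      refine Submodule.span_mono ?_ this
      rintro _ ⟨g, hg, rfl⟩
      exact ⟨a, g, hg, rfl⟩
    refine ⟨⟨_, tmul_mem⟩, ?_⟩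
    calc projectiveNorm A B (a ⊗ₜ b - a ⊗ₜ c) ≤ ‖a‖ * ‖b - c‖ := by
          rw [← TensorProduct.tmul_sub]
          exact projectiveNorm_tmul_le _ _
      _ ≤ ‖a‖ * (ε / (‖a‖ + 1)) := by gcongr; exact (dist_eq_norm b c ▸ hbc).le
      _ < ε := by
        rw [mul_div_assoc', div_lt_iff₀ (by positivity)]
        nlinarith [norm_nonneg a]
  | add s t hs ht =>
    intro ε hε
    obtain ⟨v, hv⟩ := hs (ε / 2) (half_pos hε)
    obtain ⟨w, hw⟩ := ht (ε / 2) (half_pos hε)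
    refine ⟨v + w, ?_⟩
    rw [Submodule.coe_add, add_sub_add_comm]
    exact (map_add_le_add _ _ _).trans_lt (by linarith)

end ProjectiveNorm

namespace ConvAlgebra

variable {A : Type*} [CStarAlgebra A] {α : CircleAction A}

theorem l1Norm_mul_le (f g : ConvAlgebra α) : l1Norm α (f * g) ≤ l1Norm α f * l1Norm α g := by
  calc l1Norm α (f * g) ≤ ∫ t, (∫ s, ‖f s‖ * ‖g (s⁻¹ * t)‖ ∂circleHaar) ∂circleHaar := by
        refine integral_mono (integrable_circle (by fun_prop))
          (integrable_circle (continuous_circle_integral (by unfold Function.uncurry; fun_prop)))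
          fun t => ?_
        refine norm_integral_le_of_norm_le (integrable_circle (by fun_prop))
          (.of_forall fun s => ?_)
        refine (norm_mul_le _ _).trans_eq ?_
        rw [StarAlgEquiv.norm_map]
    _ = ∫ s, (∫ t, ‖f s‖ * ‖g (s⁻¹ * t)‖ ∂circleHaar) ∂circleHaar :=
        integral_integral_swap (integrable_circle_prod (by unfold Function.uncurry; fun_prop))
    _ = ∫ s, ‖f s‖ * l1Norm α g ∂circleHaar := by
        congr 1 with s
        rw [integral_const_mul, integral_mul_left_eq_self (fun t => ‖g t‖)]
        rfl
    _ = l1Norm α f * l1Norm α g := integral_mul_const _ _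

theorem l1Norm_star (f : ConvAlgebra α) : l1Norm α (star f) = l1Norm α f := by
  simp only [l1Norm, star_apply, StarAlgEquiv.norm_map, norm_star]
  exact integral_inv_eq_self (fun t => ‖f t‖) circleHaar

variable (α) in
/-- The `L¹`-norm as a seminorm. -/
def l1Seminorm : Seminorm ℂ (ConvAlgebra α) :=
  Seminorm.of (l1Norm α)
    (fun f g => by
      rw [l1Norm, l1Norm, l1Norm, ← integral_add (integrable_circle (by fun_prop))
        (integrable_circle (by fun_prop))]
      exact integral_mono (integrable_circle (by fun_prop)) (integrable_circle (by fun_prop))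
        fun t => norm_add_le _ _)
    (fun r f => by
      simp only [l1Norm, smul_apply, norm_smul]
      exact integral_const_mul _ _)

theorem isStarAlgebraSeminorm_l1Seminorm : IsStarAlgebraSeminorm (l1Seminorm α) where
  map_mul_le := l1Norm_mul_le
  map_star := l1Norm_star

theorem l1Norm_le_of_norm_le {f : ConvAlgebra α} {C : ℝ} (h : ∀ t, ‖f t‖ ≤ C) :
    l1Norm α f ≤ C := by
  have := integral_mono (μ := circleHaar) (g := fun _ => C)
    (integrable_circle (f := fun t => ‖f t‖) (by fun_prop)) (integrable_const C) h
  rwa [integral_const, probReal_univ, one_smul] at this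

end ConvAlgebra

/-! ### Matrix units in the convolution algebra -/

section UnitaryTwist

variable {A : Type*} [CStarAlgebra A] (u : unitary A)

/-- The map `a ↦ u⁻ⁱ a uʲ`, which carries the fixed point algebra onto the `(j - i)`-th spectral
subspace when `u` is an eigenunitary. -/
def unitaryTwist (i j : ℤ) : A →ₗ[ℂ] A :=
  LinearMap.mulLeftRight ℂ ((↑(u ^ (-i)) : A), (↑(u ^ j) : A))

theorem unitaryTwist_apply (i j : ℤ) (a : A) :
    unitaryTwist u i j a = ↑(u ^ (-i)) * a * ↑(u ^ j) := rfl

theorem norm_unitaryTwist (i j : ℤ) (a : A) : ‖unitaryTwist u i j a‖ = ‖a‖ := by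
  rw [unitaryTwist_apply, CStarRing.norm_mul_coe_unitary, CStarRing.norm_coe_unitary_mul]

theorem unitaryTwist_mul_unitaryTwist (i j k : ℤ) (a b : A) :
    unitaryTwist u i j a * unitaryTwist u j k b = unitaryTwist u i k (a * b) := by
  have cancel : (↑(u ^ j) : A) * ↑(u ^ (-j)) = 1 := by
    rw [← Submonoid.coe_mul, ← zpow_add, add_neg_cancel, zpow_zero, Submonoid.coe_one]
  simp only [unitaryTwist_apply]
  calc ↑(u ^ (-i)) * a * ↑(u ^ j) * (↑(u ^ (-j)) * b * ↑(u ^ k))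
      = ↑(u ^ (-i)) * a * (↑(u ^ j) * ↑(u ^ (-j))) * b * ↑(u ^ k) := by simp only [mul_assoc]
    _ = ↑(u ^ (-i)) * (a * b) * ↑(u ^ k) := by rw [cancel, mul_one, mul_assoc _ a b]

theorem star_coe_zpow (n : ℤ) : star (↑(u ^ n) : A) = ↑(u ^ (-n)) := by
  rw [zpow_neg, ← Unitary.star_eq_inv, Unitary.coe_star]

theorem star_unitaryTwist (i j : ℤ) (a : A) :
    star (unitaryTwist u i j a) = unitaryTwist u j i (star a) := by
  simp only [unitaryTwist_apply, star_mul, star_coe_zpow, neg_neg, mul_assoc]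

theorem unitaryTwist_unitaryTwist_neg (i j : ℤ) (a : A) :
    unitaryTwist u i j (unitaryTwist u (-i) (-j) a) = a := by
  have cancel (n : ℤ) : (↑(u ^ (-n)) : A) * ↑(u ^ n) = 1 := by
    rw [← Submonoid.coe_mul, ← zpow_add, neg_add_cancel, zpow_zero, Submonoid.coe_one]
  simp only [unitaryTwist_apply, neg_neg]
  rw [mul_assoc, mul_assoc, cancel, mul_one, ← mul_assoc, cancel, one_mul]

theorem map_unitaryTwist {B : Type*} [CStarAlgebra B] {v : unitary B} {φ : A →⋆ₐ[ℂ] B}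
    (h : φ u = v) (i j : ℤ) (a : A) : φ (unitaryTwist u i j a) = unitaryTwist v i j (φ a) := by
  let ψ : A →⋆* B := ⟨(φ : A →* B), map_star φ⟩
  have map_zpow (n : ℤ) : φ ↑(u ^ n) = ↑(v ^ n) := by
    rw [← (Subtype.ext h : Unitary.map ψ u = v), ← map_zpow]
    rfl
  simp only [unitaryTwist_apply, map_mul, map_zpow]

end UnitaryTwist

namespace CircleAction

variable {A : Type*} [CStarAlgebra A] {α : CircleAction A} {u : unitary A}

theorem coe_zpow_mem_spectralSubspace {m : ℤ} (hu : (u : A) ∈ α.spectralSubspace m) (n : ℤ) :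
    (↑(u ^ n) : A) ∈ α.spectralSubspace (n * m) := by
  induction n with
  | zero =>
    rw [zpow_zero, zero_mul]
    exact mem_fixedPoints_iff.mp (one_mem _)
  | succ n ih =>
    rw [zpow_add_one, add_one_mul]
    exact mul_mem_spectralSubspace ih hu
  | pred n ih =>
    rw [zpow_sub_one, sub_one_mul, ← Unitary.star_eq_inv]
    exact mul_mem_spectralSubspace ih (star_mem_spectralSubspace hu)

theorem unitaryTwist_mem_spectralSubspace (hu : (u : A) ∈ α.spectralSubspace 1) {n : ℤ} {a : A}
    (ha : a ∈ α.spectralSubspace n) (i j : ℤ) :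
    unitaryTwist u i j a ∈ α.spectralSubspace (n + j - i) := by
  have := mul_mem_spectralSubspace (mul_mem_spectralSubspace
    (coe_zpow_mem_spectralSubspace hu (-i)) ha) (coe_zpow_mem_spectralSubspace hu j)
  rw [unitaryTwist_apply, show n + j - i = -i * 1 + n + j * 1 by ring]
  exact this

end CircleAction

namespace ConvAlgebra

open CircleAction

variable {A : Type*} [CStarAlgebra A] (α : CircleAction A) (u : unitary A)

/-- The element `t ↦ tʲ u⁻ⁱ d uʲ` of the convolution algebra: for an eigenunitary `u` these behave
like the matrices `d ⊗ eᵢⱼ`. -/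
def convUnit (i j : ℤ) : α.fixedPoints →ₗ[ℂ] ConvAlgebra α :=
  (trigMonomial j : A →L[ℂ] C(Circle, A)).toLinearMap ∘ₗ unitaryTwist u i j ∘ₗ
    α.fixedPoints.subtype.toLinearMap

theorem convUnit_apply (i j : ℤ) (d : α.fixedPoints) (t : Circle) :
    convUnit α u i j d t = ((t ^ j : Circle) : ℂ) • unitaryTwist u i j d := rfl

theorem l1Norm_convUnit_le (i j : ℤ) (d : α.fixedPoints) : l1Norm α (convUnit α u i j d) ≤ ‖d‖ :=
  l1Norm_le_of_norm_le fun t => by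
    rw [convUnit_apply, norm_smul, Circle.norm_coe, one_mul, norm_unitaryTwist]
    rfl

variable {α u}

theorem unitaryTwist_fixedPoint_mem (hu : (u : A) ∈ α.spectralSubspace 1) (i j : ℤ)
    (d : α.fixedPoints) : unitaryTwist u i j d ∈ α.spectralSubspace (j - i) := by
  simpa only [zero_add] using
    unitaryTwist_mem_spectralSubspace hu (mem_fixedPoints_iff.mp d.2) i j

theorem convUnit_mul (hu : (u : A) ∈ α.spectralSubspace 1) (i j k l : ℤ) (c d : α.fixedPoints) :
    convUnit α u i j c * convUnit α u k l d = if j = k then convUnit α u i l (c * d) else 0 := by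
  ext t
  have coeff_eq (s : Circle) :
      s ^ j * ((s⁻¹ * t) ^ l * s ^ (l - k)) = s ^ (j - k) * t ^ l := by
    rw [mul_zpow, mul_right_comm, inv_zpow', ← zpow_add, ← mul_assoc, ← zpow_add]
    congr 2
    ring
  have integrand_eq (s : Circle) : convUnit α u i j c s * α s (convUnit α u k l d (s⁻¹ * t)) =
      ((s ^ (j - k) : Circle) : ℂ) • ((t ^ l : Circle) : ℂ) •
        (unitaryTwist u i j c * unitaryTwist u k l d) := by
    rw [convUnit_apply, convUnit_apply, map_smul, unitaryTwist_fixedPoint_mem hu k l d s,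
      smul_smul, smul_mul_smul_comm, smul_smul, ← Circle.coe_mul, ← Circle.coe_mul,
      ← Circle.coe_mul, coeff_eq]
  rw [mul_apply]
  simp only [integrand_eq, integral_zpow_smul, sub_eq_zero]
  split_ifs with hjk
  · rw [hjk, unitaryTwist_mul_unitaryTwist]
    rfl
  · rfl

theorem star_convUnit (hu : (u : A) ∈ α.spectralSubspace 1) (i j : ℤ) (d : α.fixedPoints) :
    star (convUnit α u i j d) = convUnit α u j i (star d) := by
  ext t
  have coeff_eq : star (((t⁻¹ ^ j : Circle) : ℂ)) = ((t ^ j : Circle) : ℂ) := by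
    rw [inv_zpow, Circle.coe_inv_eq_conj]
    exact star_star _
  have mem : unitaryTwist u j i (star d : A) ∈ α.spectralSubspace (i - j) :=
    unitaryTwist_fixedPoint_mem hu j i (star d)
  rw [star_apply, convUnit_apply, convUnit_apply, star_smul, map_smul, star_unitaryTwist, mem,
    smul_smul, coeff_eq, ← Circle.coe_mul, ← zpow_add, add_sub_cancel]
  rfl

variable (α) in
/-- The Fourier coefficients of an element of the convolution algebra. -/
def convFourierCoeff (j : ℤ) : ConvAlgebra α →ₗ[ℂ] A where
  toFun f := ∫ t, ((t ^ (-j) : Circle) : ℂ) • f t ∂circleHaar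
  map_add' f g := by
    simp only [add_apply, smul_add]
    exact integral_add (integrable_circle (by fun_prop)) (integrable_circle (by fun_prop))
  map_smul' r f := by
    simp only [smul_apply, smul_comm _ r]
    exact integral_smul _ _

theorem norm_convFourierCoeff_le (j : ℤ) (f : ConvAlgebra α) :
    ‖convFourierCoeff α j f‖ ≤ l1Norm α f := by
  refine (norm_integral_le_integral_norm _).trans_eq ?_
  simp only [norm_smul, Circle.norm_coe, one_mul]
  rfl

theorem convFourierCoeff_convUnit (i j k : ℤ) (d : α.fixedPoints) :
    convFourierCoeff α k (convUnit α u i j d) = if j = k then unitaryTwist u i j d else 0 := by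
  change ∫ t, ((t ^ (-k) : Circle) : ℂ) • convUnit α u i j d t ∂circleHaar = _
  simp only [convUnit_apply, smul_smul, ← Circle.coe_mul, ← zpow_add, integral_zpow_smul,
    neg_add_eq_zero, eq_comm]

variable (α) in
/-- The `(i, j)` entry of an element of the convolution algebra, regarded as an infinite matrix
with respect to the units `convUnit`; it is not yet twisted back into the fixed point algebra. -/
def convEntry (i j : ℤ) : ConvAlgebra α →ₗ[ℂ] A :=
  (α.spectralProj (j - i)).toLinearMap ∘ₗ convFourierCoeff α j

theorem norm_convEntry_le (i j : ℤ) (f : ConvAlgebra α) : ‖convEntry α i j f‖ ≤ l1Norm α f :=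
  (α.norm_spectralProj_le _ _).trans (norm_convFourierCoeff_le j f)

theorem convEntry_convUnit (hu : (u : A) ∈ α.spectralSubspace 1) (i j k l : ℤ)
    (d : α.fixedPoints) : convEntry α i j (convUnit α u k l d) =
      if i = k ∧ l = j then unitaryTwist u i j d else 0 := by
  change α.spectralProj (j - i) (convFourierCoeff α j (convUnit α u k l d)) = _
  rw [convFourierCoeff_convUnit]
  rcases eq_or_ne l j with rfl | hl
  · rw [if_pos rfl, spectralProj_apply_of_mem (unitaryTwist_fixedPoint_mem hu k l d)]
    simp only [sub_right_inj, and_true, eq_comm (a := i)]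
    split_ifs with hk
    · rw [hk]
    · rfl
  · rw [if_neg hl, map_zero, if_neg fun h => hl h.2]

theorem hasDenseRange_span_convUnit (hu : (u : A) ∈ α.spectralSubspace 1) :
    HasDenseRange (l1Seminorm α)
      ((↑) : Submodule.span ℂ {g : ConvAlgebra α | ∃ i j d, g = convUnit α u i j d} →
        ConvAlgebra α) := by
  let V : Submodule ℂ C(Circle, A) :=
    Submodule.span ℂ {g : ConvAlgebra α | ∃ i j d, g = convUnit α u i j d}
  have trigMonomial_mem (m : ℤ) (a : A) : trigMonomial m a ∈ V.topologicalClosure := by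
    refine map_mem_topologicalClosure_of_span (trigMonomial m) ?_
      (α.mem_topologicalClosure_span_spectralSubspace a)
    rintro b ⟨n, hb⟩
    have fixed : unitaryTwist u (-(m - n)) (-m) b ∈ α.fixedPoints := by
      rw [mem_fixedPoints_iff, show 0 = n + -m - -(m - n) by ring]
      exact unitaryTwist_mem_spectralSubspace hu hb (-(m - n)) (-m)
    refine V.le_topologicalClosure (Submodule.subset_span ⟨m - n, m, ⟨_, fixed⟩, ?_⟩)
    ext t
    rw [convUnit_apply, unitaryTwist_unitaryTwist_neg]
    rfl
  intro f ε hε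
  have hf : (f : C(Circle, A)) ∈ V.topologicalClosure :=
    map_mem_topologicalClosure_of_span (.id ℂ C(Circle, A))
      (by rintro _ ⟨m, a, rfl⟩; exact trigMonomial_mem m a)
      (mem_topologicalClosure_span_trigMonomial (E := A) f)
  obtain ⟨g, hg, hfg⟩ := Metric.mem_closure_iff.mp hf ε hε
  refine ⟨⟨g, hg⟩, lt_of_le_of_lt (l1Norm_le_of_norm_le fun t => ?_) hfg⟩
  refine (dist_eq_norm _ _).symm.trans_le ?_
  exact ContinuousMap.dist_apply_le_dist (f := (f : C(Circle, A))) (g := g) t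

end ConvAlgebra

/-! ### The crossed product as a stabilization of the fixed point algebra -/

theorem seminorm_sum_sum_le {X ι : Type*} [AddCommGroup X] [Module ℂ X] (p : Seminorm ℂ X)
    (S : Finset ι) {x : ι → ι → X} {C : ℝ} (h : ∀ i ∈ S, ∀ j ∈ S, p (x i j) ≤ C) :
    p (∑ i ∈ S, ∑ j ∈ S, x i j) ≤ (S.card * S.card : ℝ) * C := by
  have seminorm_sum_le (y : ι → X) (D : ℝ) (hD : ∀ i ∈ S, p (y i) ≤ D) :
      p (∑ i ∈ S, y i) ≤ S.card * D := by
    rw [← nsmul_eq_mul]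
    exact (Finset.le_sum_of_subadditive p (map_zero p).le (map_add_le_add p) S y).trans
      (Finset.sum_le_card_nsmul _ _ _ hD)
  rw [mul_assoc]
  exact seminorm_sum_le _ _ fun i hi => seminorm_sum_le _ _ (h i hi)

theorem sum_sum_ite_eq {ι M : Type*} [DecidableEq ι] [AddCommMonoid M] {S : Finset ι} {i j : ι}
    (hi : i ∈ S) (hj : j ∈ S) (f : ι → ι → M) :
    ∑ k ∈ S, ∑ l ∈ S, (if i = k ∧ l = j then f k l else 0) = f i j := by
  simp only [ite_and, Finset.sum_ite_irrel, Finset.sum_const_zero, Finset.sum_ite_eq,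
    Finset.sum_ite_eq', if_pos hi, if_pos hj]

section SpanStarSubalgebra

variable {R X : Type*} [CommSemiring R] [StarRing R] [NonUnitalSemiring X] [StarRing X] [Module R X]
  [IsScalarTower R X X] [SMulCommClass R X X] [StarModule R X]

/-- The *-subalgebra of linear combinations of elements of `G`, when `G` is closed under products
and adjoints up to linear combinations. -/
def spanStarSubalgebra (G : Set X)
    (hmul : ∀ x ∈ G, ∀ y ∈ G, x * y ∈ Submodule.span R G)
    (hstar : ∀ x ∈ G, star x ∈ Submodule.span R G) : NonUnitalStarSubalgebra R X :=
  { Submodule.span R G with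
    mul_mem' := fun {x y} hx hy => by
      refine Submodule.span_induction₂ (p := fun x y _ _ => x * y ∈ Submodule.span R G)
        (fun x y hx hy => hmul x hx y hy) ?_ ?_ ?_ ?_ ?_ ?_ hx hy
      · simp
      · simp
      · intro x y z _ _ _ hxz hyz
        rw [add_mul]
        exact add_mem hxz hyz
      · intro x y z _ _ _ hxy hxz
        rw [mul_add]
        exact add_mem hxy hxz
      · intro r x y _ _ hxy
        rw [smul_mul_assoc]
        exact Submodule.smul_mem _ r hxy
      · intro r x y _ _ hxy
        rw [mul_smul_comm]
        exact Submodule.smul_mem _ r hxy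
    star_mem' := fun {x} hx => by
      refine Submodule.span_induction (p := fun x _ => star x ∈ Submodule.span R G)
        hstar ?_ ?_ ?_ hx
      · simp
      · intro x y _ _ hx hy
        rw [star_add]
        exact add_mem hx hy
      · intro r x _ hx
        rw [star_smul]
        exact Submodule.smul_mem _ _ hx }

end SpanStarSubalgebra

section Stabilization

variable {A H : Type*} [CStarAlgebra A] [NormedAddCommGroup H] [InnerProductSpace ℂ H]
  [CompleteSpace H] (α : CircleAction A) (u : unitary A) (e : HilbertBasis ℤ ℂ H)

/-- The pair formed by the matrix unit `convUnit α u i j d` of the convolution algebra and the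
elementary tensor `d ⊗ eᵢⱼ`. Elements `x` and `y` of the two algebras correspond to each other if
`(x, y)` is a linear combination of such pairs. -/
def pairUnit (i j : ℤ) :
    α.fixedPoints →ₗ[ℂ] ConvAlgebra α × (α.fixedPoints ⊗[ℂ] compactOperators H) :=
  (ConvAlgebra.convUnit α u i j).prod ((TensorProduct.mk ℂ _ _).flip (matrixUnit e i j))

theorem pairUnit_apply (i j : ℤ) (d : α.fixedPoints) :
    pairUnit α u e i j d = (ConvAlgebra.convUnit α u i j d, d ⊗ₜ matrixUnit e i j) := rfl

/-- The pairs of corresponding matrix units with indices in `S`. -/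
def pairUnits (S : Set ℤ) : Set (ConvAlgebra α × (α.fixedPoints ⊗[ℂ] compactOperators H)) :=
  {x | ∃ i ∈ S, ∃ j ∈ S, ∃ d, x = pairUnit α u e i j d}

variable {α u e}

theorem pairUnit_mul (hu : (u : A) ∈ α.spectralSubspace 1) (i j k l : ℤ) (c d : α.fixedPoints) :
    pairUnit α u e i j c * pairUnit α u e k l d =
      if j = k then pairUnit α u e i l (c * d) else 0 := by
  rw [pairUnit_apply, pairUnit_apply, Prod.mk_mul_mk, ConvAlgebra.convUnit_mul hu,
    Algebra.TensorProduct.tmul_mul_tmul, matrixUnit_mul_matrixUnit]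
  split_ifs
  · rfl
  · rw [TensorProduct.tmul_zero]
    rfl

theorem star_pairUnit (hu : (u : A) ∈ α.spectralSubspace 1) (i j : ℤ) (d : α.fixedPoints) :
    star (pairUnit α u e i j d) = pairUnit α u e j i (star d) := by
  refine Prod.ext (ConvAlgebra.star_convUnit hu i j d) ?_
  change star (d ⊗ₜ[ℂ] matrixUnit e i j) = star d ⊗ₜ[ℂ] matrixUnit e j i
  rw [TensorProduct.star_tmul, star_matrixUnit]

variable (e) in
/-- The *-algebra of pairs of corresponding finite matrices with indices in `S`. -/
def pairAlgebra (hu : (u : A) ∈ α.spectralSubspace 1) (S : Set ℤ) :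
    NonUnitalStarSubalgebra ℂ (ConvAlgebra α × (α.fixedPoints ⊗[ℂ] compactOperators H)) :=
  spanStarSubalgebra (pairUnits α u e S)
    (by
      rintro _ ⟨i, hi, j, _, c, rfl⟩ _ ⟨k, _, l, hl, d, rfl⟩
      rw [pairUnit_mul hu]
      split_ifs
      · exact Submodule.subset_span ⟨i, hi, l, hl, _, rfl⟩
      · exact zero_mem _)
    (by
      rintro _ ⟨i, hi, j, hj, d, rfl⟩
      rw [star_pairUnit hu]
      exact Submodule.subset_span ⟨j, hj, i, hi, _, rfl⟩)

theorem exists_eq_sum_pairUnit {S : Finset ℤ}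
    {x : ConvAlgebra α × (α.fixedPoints ⊗[ℂ] compactOperators H)}
    (hx : x ∈ Submodule.span ℂ (pairUnits α u e S)) :
    ∃ d : ℤ → ℤ → α.fixedPoints, x = ∑ i ∈ S, ∑ j ∈ S, pairUnit α u e i j (d i j) := by
  induction hx using Submodule.span_induction with
  | mem x hx =>
    obtain ⟨i, hi, j, hj, d, rfl⟩ := hx
    refine ⟨fun k l => if i = k ∧ l = j then d else 0, ?_⟩
    simp only [apply_ite (pairUnit α u e _ _), map_zero]
    exact (sum_sum_ite_eq hi hj fun k l => pairUnit α u e k l d).symm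
  | zero => exact ⟨0, by simp⟩
  | add x y _ _ hx hy =>
    obtain ⟨c, rfl⟩ := hx
    obtain ⟨d, rfl⟩ := hy
    exact ⟨c + d, by simp only [Pi.add_apply, map_add, Finset.sum_add_distrib]⟩
  | smul r x _ hx =>
    obtain ⟨c, rfl⟩ := hx
    exact ⟨r • c, by simp only [Pi.smul_apply, map_smul, Finset.smul_sum]⟩

theorem pairUnits_mono {S T : Set ℤ} (h : S ⊆ T) : pairUnits α u e S ⊆ pairUnits α u e T := by
  rintro _ ⟨i, hi, j, hj, d, rfl⟩
  exact ⟨i, h hi, j, h hj, d, rfl⟩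

theorem exists_finset_mem_span_pairUnits
    {x : ConvAlgebra α × (α.fixedPoints ⊗[ℂ] compactOperators H)}
    (hx : x ∈ Submodule.span ℂ (pairUnits α u e Set.univ)) :
    ∃ S : Finset ℤ, x ∈ Submodule.span ℂ (pairUnits α u e S) := by
  induction hx using Submodule.span_induction with
  | mem x hx =>
    obtain ⟨i, -, j, -, d, rfl⟩ := hx
    exact ⟨{i, j}, Submodule.subset_span ⟨i, by simp, j, by simp, d, rfl⟩⟩
  | zero => exact ⟨∅, zero_mem _⟩
  | add x y _ _ hx hy =>
    obtain ⟨S, hS⟩ := hx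
    obtain ⟨T, hT⟩ := hy
    exact ⟨S ∪ T, add_mem
      (Submodule.span_mono (pairUnits_mono (Finset.coe_subset.mpr Finset.subset_union_left)) hS)
      (Submodule.span_mono (pairUnits_mono (Finset.coe_subset.mpr Finset.subset_union_right)) hT)⟩
  | smul r x _ hx =>
    obtain ⟨S, hS⟩ := hx
    exact ⟨S, Submodule.smul_mem _ r hS⟩

theorem norm_coeff_le_l1Norm (hu : (u : A) ∈ α.spectralSubspace 1) {S : Finset ℤ}
    (d : ℤ → ℤ → α.fixedPoints) {i j : ℤ} (hi : i ∈ S) (hj : j ∈ S) :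
    ‖d i j‖ ≤ ConvAlgebra.l1Norm α
      (∑ i ∈ S, ∑ j ∈ S, ConvAlgebra.convUnit α u i j (d i j)) := by
  refine le_of_eq_of_le ?_ (ConvAlgebra.norm_convEntry_le i j _)
  simp only [map_sum, ConvAlgebra.convEntry_convUnit hu]
  rw [sum_sum_ite_eq hi hj fun k l => unitaryTwist u i j (d k l : A), norm_unitaryTwist]
  rfl

theorem norm_coeff_le_projectiveNorm {D : Type*} [NonUnitalCStarAlgebra D] {ι : Type*}
    (e : HilbertBasis ι ℂ H) {S : Finset ι} (d : ι → ι → D) {i j : ι} (hi : i ∈ S) (hj : j ∈ S) :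
    ‖d i j‖ ≤ projectiveNorm D (compactOperators H)
      (∑ i ∈ S, ∑ j ∈ S, d i j ⊗ₜ matrixUnit e i j) := by
  classical
  refine le_of_eq_of_le ?_ (norm_slice_le (norm_matrixEntry_le e i j) _)
  simp only [map_sum, slice_tmul, matrixEntry_matrixUnit, ite_smul, one_smul, zero_smul]
  rw [sum_sum_ite_eq hi hj d]

theorem l1Norm_le_mul_projectiveNorm {S : Finset ℤ}
    {x : ConvAlgebra α × (α.fixedPoints ⊗[ℂ] compactOperators H)}
    (hx : x ∈ Submodule.span ℂ (pairUnits α u e S)) :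
    ConvAlgebra.l1Norm α x.1 ≤ (S.card * S.card : ℝ) *
      projectiveNorm α.fixedPoints (compactOperators H) x.2 := by
  obtain ⟨d, rfl⟩ := exists_eq_sum_pairUnit hx
  simp only [Prod.fst_sum, Prod.snd_sum, pairUnit_apply]
  exact seminorm_sum_sum_le (ConvAlgebra.l1Seminorm α) S fun i hi j hj =>
    (ConvAlgebra.l1Norm_convUnit_le α u i j (d i j)).trans
      (norm_coeff_le_projectiveNorm e d hi hj)

theorem projectiveNorm_le_mul_l1Norm (hu : (u : A) ∈ α.spectralSubspace 1) {S : Finset ℤ}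
    {x : ConvAlgebra α × (α.fixedPoints ⊗[ℂ] compactOperators H)}
    (hx : x ∈ Submodule.span ℂ (pairUnits α u e S)) :
    projectiveNorm α.fixedPoints (compactOperators H) x.2 ≤
      (S.card * S.card : ℝ) * ConvAlgebra.l1Norm α x.1 := by
  obtain ⟨d, rfl⟩ := exists_eq_sum_pairUnit hx
  simp only [Prod.fst_sum, Prod.snd_sum, pairUnit_apply]
  refine seminorm_sum_sum_le (projectiveSeminorm α.fixedPoints (compactOperators H)) S
    fun i hi j hj => (projectiveNorm_tmul_le _ _).trans ?_
  rw [norm_matrixUnit, mul_one]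
  exact norm_coeff_le_l1Norm hu d hi hj

theorem hasDenseRange_fst_pairAlgebra (hu : (u : A) ∈ α.spectralSubspace 1) :
    HasDenseRange (ConvAlgebra.l1Seminorm α) fun z : pairAlgebra e hu Set.univ => z.1.1 := by
  intro f ε hε
  obtain ⟨⟨g, hg⟩, hfg⟩ := ConvAlgebra.hasDenseRange_span_convUnit hu f ε hε
  have hle : Submodule.span ℂ {g : ConvAlgebra α | ∃ i j d, g = ConvAlgebra.convUnit α u i j d} ≤
      (Submodule.span ℂ (pairUnits α u e Set.univ)).map (LinearMap.fst ℂ _ _) := by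
    rw [Submodule.span_le]
    rintro _ ⟨i, j, d, rfl⟩
    exact ⟨_, Submodule.subset_span ⟨i, trivial, j, trivial, d, rfl⟩, rfl⟩
  obtain ⟨x, hx, rfl⟩ := hle hg
  exact ⟨⟨x, hx⟩, hfg⟩

theorem hasDenseRange_snd_pairAlgebra (hu : (u : A) ∈ α.spectralSubspace 1) :
    HasDenseRange (projectiveSeminorm α.fixedPoints (compactOperators H))
      fun z : pairAlgebra e hu Set.univ => z.1.2 := by
  intro t ε hε
  obtain ⟨⟨s, hs⟩, hts⟩ :=
    hasDenseRange_span_tmul (mem_topologicalClosure_span_matrixUnit e) t ε hε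
  have hle : Submodule.span ℂ {t : α.fixedPoints ⊗[ℂ] compactOperators H |
        ∃ d, ∃ K ∈ {K | ∃ i j, K = matrixUnit e i j}, t = d ⊗ₜ K} ≤
      (Submodule.span ℂ (pairUnits α u e Set.univ)).map (LinearMap.snd ℂ _ _) := by
    rw [Submodule.span_le]
    rintro _ ⟨d, _, ⟨i, j, rfl⟩, rfl⟩
    exact ⟨_, Submodule.subset_span ⟨i, trivial, j, trivial, d, rfl⟩, rfl⟩
  obtain ⟨x, hx, rfl⟩ := hle hs
  exact ⟨⟨x, hx⟩, hts⟩

theorem isLocallyDominatedOn_l1Norm_projectiveNorm (hu : (u : A) ∈ α.spectralSubspace 1) :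
    IsLocallyDominatedOn
      (fun z : ConvAlgebra α × (α.fixedPoints ⊗[ℂ] compactOperators H) => ConvAlgebra.l1Norm α z.1)
      (fun z => projectiveNorm α.fixedPoints (compactOperators H) z.2)
      (pairAlgebra e hu Set.univ) := fun z hz => by
  obtain ⟨S, hS⟩ := exists_finset_mem_span_pairUnits hz
  exact ⟨pairAlgebra e hu S, hS, S.card * S.card, by positivity,
    fun x hx => l1Norm_le_mul_projectiveNorm hx⟩

theorem isLocallyDominatedOn_projectiveNorm_l1Norm (hu : (u : A) ∈ α.spectralSubspace 1) :
    IsLocallyDominatedOn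
      (fun z : ConvAlgebra α × (α.fixedPoints ⊗[ℂ] compactOperators H) =>
        projectiveNorm α.fixedPoints (compactOperators H) z.2)
      (fun z => ConvAlgebra.l1Norm α z.1) (pairAlgebra e hu Set.univ) := fun z hz => by
  obtain ⟨S, hS⟩ := exists_finset_mem_span_pairUnits hz
  exact ⟨pairAlgebra e hu S, hS, S.card * S.card, by positivity,
    fun x hx => projectiveNorm_le_mul_l1Norm hu hx⟩

variable (e) in
/-- The isomorphism `A ⋊_α 𝕋 ≃ A^α ⊗ 𝒦(H)` determined by an eigenunitary `u` and an orthonormal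
basis of `H`. -/
def stabilization (hu : (u : A) ∈ α.spectralSubspace 1) :
    CrossedProduct α ≃⋆ₐ[ℂ] CStarTensor α.fixedPoints (compactOperators H) :=
  envelopeEquiv (b := ConvAlgebra.l1Seminorm α)
    (c := projectiveSeminorm α.fixedPoints (compactOperators H))
    ConvAlgebra.isStarAlgebraSeminorm_l1Seminorm isStarAlgebraSeminorm_projectiveSeminorm
    (V := pairAlgebra e hu Set.univ)
    (hasDenseRange_fst_pairAlgebra hu) (hasDenseRange_snd_pairAlgebra hu)
    (isLocallyDominatedOn_l1Norm_projectiveNorm hu)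
    (isLocallyDominatedOn_projectiveNorm_l1Norm hu)

theorem stabilization_of_convUnit (hu : (u : A) ∈ α.spectralSubspace 1) (i j : ℤ)
    (d : α.fixedPoints) :
    stabilization e hu (CStarEnvelope.of _ (ConvAlgebra.convUnit α u i j d)) =
      CStarEnvelope.of _ (d ⊗ₜ matrixUnit e i j) :=
  envelopeEquiv_of (b := ConvAlgebra.l1Seminorm α)
    (c := projectiveSeminorm α.fixedPoints (compactOperators H))
    ConvAlgebra.isStarAlgebraSeminorm_l1Seminorm isStarAlgebraSeminorm_projectiveSeminorm
    (V := pairAlgebra e hu Set.univ)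
    (hasDenseRange_fst_pairAlgebra hu) (hasDenseRange_snd_pairAlgebra hu)
    (isLocallyDominatedOn_l1Norm_projectiveNorm hu)
    (isLocallyDominatedOn_projectiveNorm_l1Norm hu)
    (Submodule.subset_span ⟨i, trivial, j, trivial, d, rfl⟩)

end Stabilization

section Naturality

variable {A B H : Type*} [CStarAlgebra A] [CStarAlgebra B] [NormedAddCommGroup H]
  [InnerProductSpace ℂ H] [CompleteSpace H] {α : CircleAction A} {β : CircleAction B}
  {u : unitary A} {v : unitary B}

theorem ConvAlgebra.map_convUnit {φ : A →⋆ₐ[ℂ] B} (hφ : α.IsEquivariant β φ) (huv : φ u = v)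
    (i j : ℤ) (d : α.fixedPoints) :
    ConvAlgebra.map φ hφ (convUnit α u i j d) =
      convUnit β v i j (CircleAction.fixedPointsMap φ hφ d) := by
  ext t
  rw [map_apply, convUnit_apply, convUnit_apply, map_smul, map_unitaryTwist u huv]
  rfl

theorem stabilization_map (e : HilbertBasis ℤ ℂ H) (hu : (u : A) ∈ α.spectralSubspace 1)
    (hv : (v : B) ∈ β.spectralSubspace 1) {φ : A →⋆ₐ[ℂ] B} (hφ : α.IsEquivariant β φ)
    (huv : φ u = v) (x : CrossedProduct α) :
    stabilization e hv (CrossedProduct.map φ hφ x) =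
      CStarTensor.map (compactOperators H) (CircleAction.fixedPointsMap φ hφ)
        (stabilization e hu x) := by
  let ψ := CircleAction.fixedPointsMap φ hφ
  let Φ : CrossedProduct α →⋆ₙₐ[ℂ] CStarTensor β.fixedPoints (compactOperators H) :=
    (stabilization e hv :
      CrossedProduct β →⋆ₙₐ[ℂ] CStarTensor β.fixedPoints (compactOperators H)).comp
        (CrossedProduct.map φ hφ)
  let Φ' : CrossedProduct α →⋆ₙₐ[ℂ] CStarTensor β.fixedPoints (compactOperators H) :=
    (CStarTensor.map (compactOperators H) ψ).comp
      (stabilization e hu :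
        CrossedProduct α →⋆ₙₐ[ℂ] CStarTensor α.fixedPoints (compactOperators H))
  refine CStarEnvelope.hom_ext_of_span (b := ConvAlgebra.l1Seminorm α)
    (ConvAlgebra.hasDenseRange_span_convUnit hu) (f := Φ) (g := Φ') ?_ x
  rintro _ ⟨i, j, d, rfl⟩
  change stabilization e hv (CrossedProduct.map φ hφ (CStarEnvelope.of _ _)) =
    CStarTensor.map (compactOperators H) ψ (stabilization e hu (CStarEnvelope.of _ _))
  have map_of_convUnit :
      CrossedProduct.map φ hφ (CStarEnvelope.of _ (ConvAlgebra.convUnit α u i j d)) =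
        CStarEnvelope.of _ (ConvAlgebra.map φ hφ (ConvAlgebra.convUnit α u i j d)) :=
    CStarEnvelope.map_of (ConvAlgebra.map φ hφ) (ConvAlgebra.l1Norm_map_le φ hφ) _
  rw [ConvAlgebra.map_convUnit hφ huv] at map_of_convUnit
  have map_of_tmul : CStarTensor.map (compactOperators H) ψ
      (CStarEnvelope.of _ (d ⊗ₜ matrixUnit e i j)) =
        CStarEnvelope.of _ (ψ d ⊗ₜ matrixUnit e i j) :=
    CStarEnvelope.map_of (algTensorMap (compactOperators H) ψ)
      (projectiveNorm_algTensorMap_le ψ) _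
  exact ((congrArg _ map_of_convUnit).trans (stabilization_of_convUnit hv i j (ψ d))).trans
    (map_of_tmul.symm.trans (congrArg _ (stabilization_of_convUnit hu i j d).symm))

end Naturality

/-! ### Eigenunitaries -/

theorem map_cfcAbs {A B : Type*} [CStarAlgebra A] [PartialOrder A] [StarOrderedRing A]
    [CStarAlgebra B] [PartialOrder B] [StarOrderedRing B] (φ : A →⋆ₐ[ℂ] B) (a : A) :
    φ (CFC.abs a) = CFC.abs (φ a) := by
  refine (CFC.sqrt_unique ?_ (map_nonneg φ (CFC.abs_nonneg a))).symm
  rw [← map_mul, CFC.abs_mul_abs, map_mul, map_star]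

theorem isUnit_of_norm_sub_unitary_lt_one {A : Type*} [CStarAlgebra A] {w x : A}
    (hw : w ∈ unitary A) (h : ‖w - x‖ < 1) : IsUnit x := by
  lift w to unitary A using hw
  have norm_lt : ‖star (w : A) * (w - x)‖ < 1 := by
    rwa [← Unitary.coe_star, CStarRing.norm_coe_unitary_mul]
  have factorization : (w : A) * (1 - star (w : A) * (w - x)) = x := by
    rw [mul_sub, ← mul_assoc, Unitary.mul_star_self_of_mem w.2, mul_one, one_mul, sub_sub_cancel]
  exact factorization ▸ Unitary.isUnit_coe.mul (isUnit_one_sub_of_norm_lt_one norm_lt)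

namespace CircleAction

variable {A : Type*} [CStarAlgebra A] {α : CircleAction A}

theorem mem_spectralSubspace_one_of_mem_eigenunitaries {u : A} (hu : u ∈ α.eigenunitaries) :
    u ∈ α.spectralSubspace 1 := fun ζ => by
  rw [zpow_one]
  exact hu.2 ζ

/- The unitary is the one in the polar decomposition of `x`: since `α_ζ(x)` is a multiple of `x` by
a scalar of modulus one, `|x|` is a fixed point. -/
theorem exists_mem_unitary_mem_spectralSubspace {n : ℤ} {x : A} (hx : x ∈ α.spectralSubspace n)
    (hx_unit : IsUnit x) : ∃ u ∈ unitary A, u ∈ α.spectralSubspace n := by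
  let _ : PartialOrder A := CStarAlgebra.spectralOrder A
  have _ : StarOrderedRing A := CStarAlgebra.spectralOrderedRing A
  have abs_unit : IsUnit (CFC.abs x) :=
    (CFC.isUnit_sqrt_iff _ (star_mul_self_nonneg x)).mpr (hx_unit.star.mul hx_unit)
  have abs_fixed (ζ : Circle) : α ζ (CFC.abs x) = CFC.abs x := by
    rw [show α ζ (CFC.abs x) = CFC.abs (α ζ x) from map_cfcAbs (α ζ : A →⋆ₐ[ℂ] A) x, hx ζ,
      CFC.abs_smul, Circle.norm_coe, one_smul]
  obtain ⟨c, hc⟩ := abs_unit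
  have inv_fixed (ζ : Circle) : α ζ (↑c⁻¹ : A) = ↑c⁻¹ := by
    refine left_inv_eq_right_inv (a := (c : A)) ?_ c.mul_inv
    rw [hc, ← abs_fixed ζ, ← hc, ← map_mul, c.inv_mul, map_one]
  have star_inv : star (↑c⁻¹ : A) = ↑c⁻¹ := by
    have star_c : star c = c := Units.ext <| by
      rw [Units.coe_star, hc]
      exact (CFC.abs_nonneg x).isSelfAdjoint
    rw [← Units.coe_star_inv, star_c]
  refine ⟨x * ↑c⁻¹, (hx_unit.mul c⁻¹.isUnit).mem_unitary_of_star_mul_self ?_, fun ζ => ?_⟩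
  · rw [star_mul, star_inv, mul_assoc, ← mul_assoc (star x), ← CFC.abs_mul_abs, ← hc]
    simp
  · rw [map_mul, hx ζ, inv_fixed, smul_mul_assoc]

theorem eigenunitaries_nonempty {w : A} (hw : w ∈ unitary A)
    (h : ∀ ζ, ‖α ζ w - (ζ : ℂ) • w‖ < 1) : α.eigenunitaries.Nonempty := by
  have norm_sub_lt : ‖w - α.average (trigMonomial 1 w)‖ < 1 := by
    let orbit : C(Circle, A) := ⟨fun s => α s w, α.continuous_apply w⟩
    calc ‖w - α.average (trigMonomial 1 w)‖ = ‖α.average (orbit - trigMonomial 1 w)‖ := by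
          rw [map_sub, α.average_orbit]
      _ ≤ ‖orbit - trigMonomial 1 w‖ := α.norm_average_le _
      _ < 1 := (ContinuousMap.norm_lt_iff _ one_pos).mpr fun s => by
          rw [ContinuousMap.sub_apply, trigMonomial_apply, zpow_one]
          exact h s
  obtain ⟨u, hu, hu_spectral⟩ := exists_mem_unitary_mem_spectralSubspace
    (α.average_trigMonomial_mem 1 w) (isUnit_of_norm_sub_unitary_lt_one hw norm_sub_lt)
  exact ⟨u, hu, fun ζ => by rw [hu_spectral ζ, zpow_one]⟩

end CircleAction

end CircleRokhlin

end

theorem mainTheorem12_general {H : Type*} [NormedAddCommGroup H] [InnerProductSpace ℂ H]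
    [CompleteSpace H] (e : HilbertBasis ℤ ℂ H) :
    (∀ (A : Type u) [CStarAlgebra A] (α : CircleRokhlin.CircleAction A),
      (∃ w ∈ unitary A, ∀ ζ, ‖α ζ w - (ζ : ℂ) • w‖ < 1) → α.eigenunitaries.Nonempty) ∧
    ∃ Ψ : ∀ (A : Type u) [CStarAlgebra A] (α : CircleRokhlin.CircleAction A) (u : A),
        u ∈ α.eigenunitaries → (CircleRokhlin.CrossedProduct α ≃⋆ₐ[ℂ]
          CircleRokhlin.CStarTensor α.fixedPoints (CircleRokhlin.compactOperators H)),
      ∀ (A B : Type u) [CStarAlgebra A] [CStarAlgebra B]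
        (α : CircleRokhlin.CircleAction A) (β : CircleRokhlin.CircleAction B) (u : A) (v : B)
        (hu : u ∈ α.eigenunitaries) (hv : v ∈ β.eigenunitaries)
        (φ : A →⋆ₐ[ℂ] B) (hφ : α.IsEquivariant β φ), φ u = v →
        ∀ x : CircleRokhlin.CrossedProduct α,
          Ψ B β v hv (CircleRokhlin.CrossedProduct.map φ hφ x) =
            CircleRokhlin.CStarTensor.map (CircleRokhlin.compactOperators H)
              (CircleRokhlin.CircleAction.fixedPointsMap φ hφ) (Ψ A α u hu x) := by
  refine ⟨fun A _ α ⟨w, hw, hζ⟩ => CircleRokhlin.CircleAction.eigenunitaries_nonempty hw hζ,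
    fun A _ α u hu => CircleRokhlin.stabilization (u := ⟨u, hu.1⟩) e
      (CircleRokhlin.CircleAction.mem_spectralSubspace_one_of_mem_eigenunitaries hu), ?_⟩
  intro A B _ _ α β u v hu hv φ hφ huv x
  exact CircleRokhlin.stabilization_map e _ _ hφ huv x

theorem mainTheorem12 :
    (∀ (A : Type u) [CStarAlgebra A] (α : CircleRokhlin.CircleAction A),
      α.HasRokhlinProperty → α.eigenunitaries.Nonempty) ∧
    ∃ Ψ : ∀ (A : Type u) [CStarAlgebra A] (α : CircleRokhlin.CircleAction A) (u : A),
        α.HasRokhlinProperty → u ∈ α.eigenunitaries →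
          (CircleRokhlin.CrossedProduct α ≃⋆ₐ[ℂ]
            CircleRokhlin.CStarTensor α.fixedPoints
              (CircleRokhlin.compactOperators CircleRokhlin.L2Circle)),
      ∀ (A B : Type u) [CStarAlgebra A] [CStarAlgebra B]
        (α : CircleRokhlin.CircleAction A) (β : CircleRokhlin.CircleAction B) (u : A) (v : B)
        (hα : α.HasRokhlinProperty) (hβ : β.HasRokhlinProperty)
        (hu : u ∈ α.eigenunitaries) (hv : v ∈ β.eigenunitaries)
        (φ : A →⋆ₐ[ℂ] B) (hφ : α.IsEquivariant β φ), φ u = v →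
        ∀ x : CircleRokhlin.CrossedProduct α,
          Ψ B β v hβ hv (CircleRokhlin.CrossedProduct.map φ hφ x) =
            CircleRokhlin.CStarTensor.map
              (CircleRokhlin.compactOperators CircleRokhlin.L2Circle)
              (CircleRokhlin.CircleAction.fixedPointsMap φ hφ) (Ψ A α u hα hu x) := by
  have general := mainTheorem12_general CircleRokhlin.circleBasis
  obtain ⟨exists_eigenunitary, Ψ, hΨ⟩ := general
  exact ⟨fun A _ α h => exists_eigenunitary A α ((h 1 one_pos ∅).imp fun w hw => ⟨hw.1, hw.2.1⟩),
    fun A _ α u _ => Ψ A α u, fun A B _ _ α β u v _ _ => hΨ A B α β u v⟩
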